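/- An endomorphism $\gamma$ of an abelian group $A$ is called inertial if $(H+H\gamma)/H$ is finite for every subgroup $H$ of $A$; $\mathrm{IAut}(A)$ denotes the subgroup of $\mathrm{Aut}(A)$ generated by all bijective inertial endomorphisms of $A$. A group is metabelian if its derived subgroup is abelian, and locally finite if all its finitely generated subgroups are finite. Corollary B. For every abelian group $A$, the group $\mathrm{IAut}(A)$ has a metabelian normal subgroup $\Gamma$ such that $\mathrm{IAut}(A)/\Gamma$ is locally finite. However, for every prime $p$, the group $\mathrm{IAut}(\mathbb{Z}(p^\infty)\oplus\mathbb{Z})$ has no nilpotent normal subgroup $N$ such that the quotient by $N$ is locally finite; here $\mathbb{Z}(p^\infty)=\mathbb{Q}_p/\mathbb{Z}$, where $\mathbb{Q}_p$ is the additive group of rational numbers whose denominator is a power of $p$. -/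

import Mathlib

/-- An endomorphism `γ` of an abelian group `A` is inertial if `(H + Hγ) / H` is finite for every
subgroup `H` of `A`. -/
def IsInertial {A : Type*} [AddCommGroup A] (γ : A →+ A) : Prop :=
  ∀ H : AddSubgroup A,
    Finite (↥(H ⊔ H.map γ) ⧸ H.addSubgroupOf (H ⊔ H.map γ))

/-- The group `IAut(A)` generated by all inertial automorphisms of the abelian group `A`. Mathlib
writes the composition in `AddAut A` additively, whence `Multiplicative`. -/
def IAut (A : Type*) [AddCommGroup A] : Subgroup (Multiplicative (AddAut A)) :=
  Subgroup.closure {γ | IsInertial (AddEquiv.toAddMonoidHom (Multiplicative.toAdd γ))}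

/-- A group is locally finite if each of its finitely generated subgroups is finite. -/
def IsLocallyFiniteGroup (G : Type*) [Group G] : Prop :=
  ∀ H : Subgroup G, H.FG → Finite H

/-- A group is metabelian if its derived subgroup is abelian. -/
def IsMetabelianGroup (G : Type*) [Group G] : Prop :=
  ∀ x ∈ commutator G, ∀ y ∈ commutator G, x * y = y * x

/-- `G` has a metabelian normal subgroup with locally finite quotient. -/
def IsMetabelianByLocallyFinite (G : Type*) [Group G] : Prop :=
  ∃ (N : Subgroup G) (_ : N.Normal), IsMetabelianGroup N ∧ IsLocallyFiniteGroup (G ⧸ N)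

/-- `G` has a nilpotent normal subgroup with locally finite quotient. -/
def IsNilpotentByLocallyFinite (G : Type*) [Group G] : Prop :=
  ∃ (N : Subgroup G) (_ : N.Normal), Group.IsNilpotent N ∧ IsLocallyFiniteGroup (G ⧸ N)

/-- The additive group of the rational numbers of the form `m / p ^ k`. -/
def primePowerDenomRat (p : ℕ) : AddSubgroup ℚ where
  carrier := {q | ∃ (m : ℤ) (k : ℕ), q * (p : ℚ) ^ k = (m : ℚ)}
  zero_mem' := ⟨0, 0, by simp⟩
  add_mem' := by
    rintro a b ⟨m, k, hm⟩ ⟨n, l, hn⟩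
    refine ⟨m * (p : ℤ) ^ l + n * (p : ℤ) ^ k, k + l, ?_⟩
    push_cast
    rw [← hm, ← hn]
    ring
  neg_mem' := by
    rintro a ⟨m, k, hm⟩
    exact ⟨-m, k, by push_cast; rw [← hm]; ring⟩

/-- The Prüfer group `ℤ(p^∞)`: rationals with denominator a power of `p`, modulo `ℤ`. -/
abbrev PrueferGroup (p : ℕ) : Type :=
  ↥(primePowerDenomRat p) ⧸ (AddSubgroup.zmultiples (1 : ℚ)).addSubgroupOf (primePowerDenomRat p)

/-! Let T be the torsion subgroup of A. The group Γ is `torsionPowerSubgroup A`: the elements of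
IAut(A) that send each torsion element to a multiple of itself. Such maps commute on T. Modulo T
every element of IAut(A) sends each a to a rational multiple of a, so commutators in Γ are trivial
on T and on A/T, and automorphisms of that kind commute.

For local finiteness, take a finite set S of inertial automorphisms. It suffices to find a finite
S-invariant X such that everything in ⟨S⟩ fixing X pointwise lies in Γ
(`exists_finite_invariant_apply_eq_zsmul`): the image of ⟨S⟩ in the quotient is then controlled by
permutations of X. By `IsInertial.exists_finite_sub_mem` an inertial map is, modulo a finite F, a
multiplication on each torsion element whose cyclic group misses F. Hence only the primes dividing
|F| matter. For such p, an infinite socle of p^k A forces one scalar, modulo F, on all elements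
killed by p^(k+1). If all these socles are infinite, S acts by exact scalars on a finite-index
subgroup of the p-component. If one is finite, the p-component is a bounded part plus a divisible
part, and inertial maps send each element of the latter to a multiple.

For the second claim, a normal N with locally finite quotient contains a power u^j of the dilation
by 1 + p. Commutation with u^j multiplies the parameter of a shear by (1 + p)^j - 1, which is
surjective on the Prüfer group, so all shears lie in every term of the lower central series of N. -/

open Multiplicative

/-! ### Finite sums of finite subgroups -/

section FiniteSubgroups

variable {A : Type*} [AddCommGroup A]

theorem AddSubgroup.finite_sup_of_finite (F G : AddSubgroup A) [Finite F] [Finite G] :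
    Finite ↥(F ⊔ G) := by
  have hF : (F : Set A).Finite := Set.toFinite _
  have hG : (G : Set A).Finite := Set.toFinite _
  refine ((hF.image2 (fun x y => x + y) hG).subset ?_ : ((F ⊔ G : AddSubgroup A) : Set A).Finite)
  intro x hx
  obtain ⟨y, hy, z, hz, rfl⟩ := AddSubgroup.mem_sup.1 hx
  exact ⟨y, hy, z, hz, rfl⟩

theorem AddSubgroup.finite_zmultiples_of_isOfFinAddOrder {a : A} (ha : IsOfFinAddOrder a) :
    Finite (AddSubgroup.zmultiples a) :=
  (finite_zmultiples.2 ha : (AddSubgroup.zmultiples a : Set A).Finite)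

theorem AddSubgroup.finite_closure_of_isOfFinAddOrder {s : Set A} (hs : s.Finite)
    (h : ∀ a ∈ s, IsOfFinAddOrder a) : Finite (AddSubgroup.closure s) := by
  induction s, hs using Set.Finite.induction_on with
  | empty => rw [AddSubgroup.closure_empty]; infer_instance
  | @insert a s _ _ ih =>
    rw [Set.insert_eq, AddSubgroup.closure_union, ← AddSubgroup.zmultiples_eq_closure]
    have := ih fun b hb => h b (Set.mem_insert_of_mem _ hb)
    have := AddSubgroup.finite_zmultiples_of_isOfFinAddOrder (h a (Set.mem_insert _ _))
    exact AddSubgroup.finite_sup_of_finite _ _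

theorem AddSubgroup.finite_biSup_of_finite {ι : Type*} {s : Set ι} (hs : s.Finite)
    (F : ι → AddSubgroup A) (h : ∀ i ∈ s, Finite (F i)) :
    Finite ↥(⨆ i ∈ s, F i) := by
  induction s, hs using Set.Finite.induction_on with
  | empty => simp only [Set.mem_empty_iff_false, iSup_false, iSup_bot]; infer_instance
  | @insert a s _ _ ih =>
    rw [iSup_insert]
    have := ih fun b hb => h b (Set.mem_insert_of_mem _ hb)
    have := h a (Set.mem_insert _ _)
    exact AddSubgroup.finite_sup_of_finite _ _

end FiniteSubgroups

/-! ### Orders of p-elements and socles -/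

section PrimaryArithmetic

variable {A : Type*} [AddCommGroup A] {p : ℕ}

/-- The `p`-primary component of an abelian group. -/
def pTorsion (A : Type*) [AddCommGroup A] (p : ℕ) : AddSubgroup A where
  carrier := {a | ∃ k : ℕ, (p : ℤ) ^ k • a = 0}
  zero_mem' := ⟨0, by simp⟩
  add_mem' := by
    rintro a b ⟨k, hk⟩ ⟨l, hl⟩
    refine ⟨k + l, ?_⟩
    rw [smul_add, pow_add, mul_smul, mul_smul, hl, smul_comm, hk]
    simp
  neg_mem' := by
    rintro a ⟨k, hk⟩
    exact ⟨k, by rw [smul_neg, hk, neg_zero]⟩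

theorem mem_pTorsion {a : A} : a ∈ pTorsion A p ↔ ∃ k : ℕ, (p : ℤ) ^ k • a = 0 := Iff.rfl

theorem pow_smul_eq_zero_of_le {a : A} {k l : ℕ} (hkl : k ≤ l) (h : (p : ℤ) ^ k • a = 0) :
    (p : ℤ) ^ l • a = 0 := by
  obtain ⟨d, rfl⟩ := Nat.exists_eq_add_of_le hkl
  rw [pow_add, mul_comm, mul_smul, h, smul_zero]

theorem map_mem_pTorsion (γ : A →+ A) {a : A} (ha : a ∈ pTorsion A p) : γ a ∈ pTorsion A p := by
  obtain ⟨k, hk⟩ := ha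
  exact ⟨k, by rw [← map_zsmul, hk, map_zero]⟩

theorem isOfFinAddOrder_of_zsmul_eq_zero {a : A} {n : ℤ} (hn : n ≠ 0) (h : n • a = 0) :
    IsOfFinAddOrder a :=
  isOfFinAddOrder_iff_zsmul_eq_zero.2 ⟨n, hn, h⟩

theorem isOfFinAddOrder_of_mem_pTorsion (hp : p.Prime) {a : A} (ha : a ∈ pTorsion A p) :
    IsOfFinAddOrder a := by
  obtain ⟨k, hk⟩ := ha
  exact isOfFinAddOrder_of_zsmul_eq_zero (pow_ne_zero _ (by exact_mod_cast hp.ne_zero)) hk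

theorem exists_mul_smul_eq_self {a : A} {m n : ℤ} (h : n • a = 0) (hmn : IsCoprime m n) :
    ∃ r : ℤ, (r * m) • a = a := by
  obtain ⟨u, v, huv⟩ := hmn
  refine ⟨u, ?_⟩
  have : (u * m + v * n) • a = a := by rw [huv, one_smul]
  rwa [add_smul, mul_smul v, h, smul_zero, add_zero] at this

theorem pow_succ_dvd_of_smul_eq_zero (hp : p.Prime) {a : A} (ha : a ∈ pTorsion A p) {k : ℕ}
    (hk : (p : ℤ) ^ k • a ≠ 0) {m : ℤ} (hm : m • a = 0) : (p : ℤ) ^ (k + 1) ∣ m := by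
  obtain ⟨r, hr⟩ := ha
  have h1 : addOrderOf a ∣ p ^ r := by
    rw [addOrderOf_dvd_iff_nsmul_eq_zero, ← natCast_zsmul]
    exact_mod_cast hr
  obtain ⟨j, -, hj⟩ := (Nat.dvd_prime_pow hp).1 h1
  have h2 : k < j := by
    by_contra! hjk
    refine hk (pow_smul_eq_zero_of_le hjk ?_)
    have := addOrderOf_nsmul_eq_zero a
    rw [hj, ← natCast_zsmul] at this
    exact_mod_cast this
  have h3 := addOrderOf_dvd_iff_zsmul_eq_zero.2 hm
  rw [hj] at h3
  push_cast at h3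
  exact (pow_dvd_pow _ h2).trans h3

/-- The subgroups of ⟨c⟩ form a chain, so a nonzero ⟨c⟩ ∩ X would contain the bottom element p^k c.
This is the test for ⟨c⟩ ∩ X = 0 used throughout. -/
theorem smul_eq_zero_of_pow_smul_notMem (hp : p.Prime) {c : A} {k : ℕ}
    (hc : (p : ℤ) ^ (k + 1) • c = 0) {X : AddSubgroup A} (hX : (p : ℤ) ^ k • c ∉ X) {m : ℤ}
    (hm : m • c ∈ X) : m • c = 0 := by
  have hd : (Int.gcd m ((p : ℤ) ^ (k + 1)) : ℤ) • c ∈ X := by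
    rw [Int.gcd_eq_gcd_ab, add_smul, mul_comm, mul_smul, mul_comm _ (Int.gcdB _ _), mul_smul, hc,
      smul_zero, add_zero]
    exact X.zsmul_mem hm _
  have h1 : Int.gcd m ((p : ℤ) ^ (k + 1)) ∣ p ^ (k + 1) := by
    have := Int.gcd_dvd_right m ((p : ℤ) ^ (k + 1))
    exact_mod_cast this
  obtain ⟨j, hj, hj'⟩ := (Nat.dvd_prime_pow hp).1 h1
  rcases Nat.lt_or_ge k j with h | h
  · have : j = k + 1 := by omega
    subst this
    have h2 := Int.gcd_dvd_left m ((p : ℤ) ^ (k + 1))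
    rw [hj'] at h2
    push_cast at h2
    obtain ⟨e, rfl⟩ := h2
    rw [mul_comm, mul_smul, hc, smul_zero]
  · exfalso
    apply hX
    obtain ⟨d, rfl⟩ := Nat.exists_eq_add_of_le h
    rw [hj'] at hd
    push_cast at hd
    rw [pow_add, mul_comm, mul_smul]
    exact X.zsmul_mem hd _

/-- The socle of `p ^ k A`. -/
def pSocle (A : Type*) [AddCommGroup A] (p k : ℕ) : Set A :=
  {y | (p : ℤ) • y = 0 ∧ ∃ c : A, (p : ℤ) ^ k • c = y}

theorem pSocle_antitone : Antitone (pSocle A p) := by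
  intro k l hkl y hy
  obtain ⟨hy, c, hc⟩ := hy
  obtain ⟨d, rfl⟩ := Nat.exists_eq_add_of_le hkl
  exact ⟨hy, (p : ℤ) ^ d • c, by rw [← mul_smul, ← pow_add, hc]⟩

theorem exists_pow_smul_notMem {k : ℕ} (h : (pSocle A p k).Infinite) (X : AddSubgroup A)
    [Finite X] : ∃ c : A, (p : ℤ) ^ (k + 1) • c = 0 ∧ (p : ℤ) ^ k • c ∉ X := by
  obtain ⟨y, ⟨hy, c, hc⟩, hX⟩ := h.exists_notMem_finite (Set.toFinite (X : Set A))
  exact ⟨c, by rw [pow_succ', mul_smul, hc, hy], by rwa [hc]⟩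

end PrimaryArithmetic

/-! ### Uniform scalars modulo a finite subgroup -/

section ScalarModulo

variable {A : Type*} [AddCommGroup A] {p : ℕ}

/-- `γ` maps each `p`-element `a` with `⟨a⟩ ∩ F = 0` into `⟨a⟩ + F`. -/
def IsPowerModulo (p : ℕ) (F : AddSubgroup A) (γ : A →+ A) : Prop :=
  ∀ a ∈ pTorsion A p, (∀ m : ℤ, m • a ∈ F → m • a = 0) → ∃ m : ℤ, γ a - m • a ∈ F

/-- Comparing γ on c and on w + c, both of which avoid F, shows that their scalars agree modulo
p^(k+1), the order of c. That power kills w, so the scalar of c also serves w, even if ⟨w⟩ meets F.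
-/
theorem IsPowerModulo.sub_smul_mem (hp : p.Prime) {F : AddSubgroup A} {γ : A →+ A}
    (h : IsPowerModulo p F γ) {k : ℕ} {w c : A} (hw : (p : ℤ) ^ (k + 1) • w = 0)
    (hc : (p : ℤ) ^ (k + 1) • c = 0)
    (hcX : (p : ℤ) ^ k • c ∉ F ⊔ (AddSubgroup.zmultiples w ⊔ AddSubgroup.zmultiples (γ w)))
    {m : ℤ} (hm : γ c - m • c ∈ F) : γ w - m • w ∈ F := by
  set X := F ⊔ (AddSubgroup.zmultiples w ⊔ AddSubgroup.zmultiples (γ w)) with hXdef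
  have hFX : F ≤ X := le_sup_left
  have hwX : w ∈ X := (le_sup_left.trans le_sup_right : AddSubgroup.zmultiples w ≤ X)
    (AddSubgroup.mem_zmultiples w)
  have hγX : γ w ∈ X := (le_sup_right.trans le_sup_right : AddSubgroup.zmultiples (γ w) ≤ X)
    (AddSubgroup.mem_zmultiples _)
  have avoid : ∀ j : ℤ, j • c ∈ X → (p : ℤ) ^ (k + 1) ∣ j := fun j hj =>
    pow_succ_dvd_of_smul_eq_zero hp ⟨_, hc⟩ (fun h0 => hcX (h0 ▸ X.zero_mem))
      (smul_eq_zero_of_pow_smul_notMem hp hc hcX hj)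
  have kill : ∀ j : ℤ, j • c ∈ X → j • w = 0 := fun j hj => by
    obtain ⟨e, rfl⟩ := avoid j hj
    rw [mul_comm, mul_smul, hw, smul_zero]
  have killc : ∀ j : ℤ, j • c ∈ X → j • c = 0 := fun j hj =>
    smul_eq_zero_of_pow_smul_notMem hp hc hcX hj
  obtain ⟨n, hn⟩ := h (w + c) ⟨k + 1, by rw [smul_add, hw, hc, add_zero]⟩ fun j hj => by
    have : j • c ∈ X := by
      have := X.sub_mem (hFX hj) (X.zsmul_mem hwX j)
      rwa [smul_add, add_sub_cancel_left] at this
    rw [smul_add, kill j this, killc j this, add_zero]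
  have h1 : (m - n) • c ∈ X := by
    have := X.sub_mem (X.sub_mem (hFX hn) (hFX hm)) (X.sub_mem hγX (X.zsmul_mem hwX n))
    convert this using 1
    rw [map_add]
    module
  have h2 := kill _ h1
  have h3 := killc _ h1
  have := F.sub_mem hn hm
  convert this using 1
  have : γ (w + c) - n • (w + c) - (γ c - m • c)
      = γ w - m • w + ((m - n) • w + (m - n) • c) := by rw [map_add]; module
  rw [this, h2, h3, add_zero, add_zero]

theorem IsPowerModulo.exists_scalar (hp : p.Prime) {F : AddSubgroup A} [Finite F] {γ : A →+ A}
    (h : IsPowerModulo p F γ) {k : ℕ} (hk : (pSocle A p k).Infinite) :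
    ∃ m : ℤ, ∀ w : A, (p : ℤ) ^ (k + 1) • w = 0 → γ w - m • w ∈ F := by
  have fin : ∀ w : A, (p : ℤ) ^ (k + 1) • w = 0 →
      Finite ↥(AddSubgroup.zmultiples w ⊔ AddSubgroup.zmultiples (γ w)) := fun w hw => by
    have hw' : w ∈ pTorsion A p := ⟨_, hw⟩
    have := AddSubgroup.finite_zmultiples_of_isOfFinAddOrder (isOfFinAddOrder_of_mem_pTorsion hp hw')
    have := AddSubgroup.finite_zmultiples_of_isOfFinAddOrder
      (isOfFinAddOrder_of_mem_pTorsion hp (map_mem_pTorsion γ hw'))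
    exact AddSubgroup.finite_sup_of_finite _ _
  obtain ⟨c₀, hc₀, hc₀F⟩ := exists_pow_smul_notMem hk F
  obtain ⟨m, hm⟩ := h c₀ ⟨_, hc₀⟩ fun j => smul_eq_zero_of_pow_smul_notMem hp hc₀ hc₀F
  refine ⟨m, fun w hw => ?_⟩
  have := fin w hw
  have := fin c₀ hc₀
  have := AddSubgroup.finite_sup_of_finite F
    (AddSubgroup.zmultiples w ⊔ AddSubgroup.zmultiples (γ w))
  have := AddSubgroup.finite_sup_of_finite F
    (AddSubgroup.zmultiples c₀ ⊔ AddSubgroup.zmultiples (γ c₀))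
  have := AddSubgroup.finite_sup_of_finite
    (F ⊔ (AddSubgroup.zmultiples w ⊔ AddSubgroup.zmultiples (γ w)))
    (F ⊔ (AddSubgroup.zmultiples c₀ ⊔ AddSubgroup.zmultiples (γ c₀)))
  -- The element c is independent of both w and c₀; it transfers the scalar of c₀ to w.
  obtain ⟨c, hc, hcX⟩ := exists_pow_smul_notMem hk
    ((F ⊔ (AddSubgroup.zmultiples w ⊔ AddSubgroup.zmultiples (γ w))) ⊔
    (F ⊔ (AddSubgroup.zmultiples c₀ ⊔ AddSubgroup.zmultiples (γ c₀))))
  have hcF : (p : ℤ) ^ k • c ∉ F := fun h => hcX (AddSubgroup.mem_sup_left (AddSubgroup.mem_sup_left h))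
  obtain ⟨n, hn⟩ := h c ⟨_, hc⟩ fun j => smul_eq_zero_of_pow_smul_notMem hp hc hcF
  have h1 := h.sub_smul_mem hp hc₀ hc (fun h => hcX (AddSubgroup.mem_sup_right h)) hn
  have h2 := h.sub_smul_mem hp hw hc (fun h => hcX (AddSubgroup.mem_sup_left h)) hn
  have h3 : (n - m) • c₀ ∈ F := by
    convert F.sub_mem hm h1 using 1
    module
  obtain ⟨e, he⟩ := pow_succ_dvd_of_smul_eq_zero hp ⟨_, hc₀⟩
    (fun h0 => hc₀F (h0 ▸ F.zero_mem)) (smul_eq_zero_of_pow_smul_notMem hp hc₀ hc₀F h3)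
  have h4 : (n - m) • w = 0 := by rw [he, mul_comm, mul_smul, hw, smul_zero]
  have h5 : γ w - m • w = γ w - n • w + (n - m) • w := by module
  rw [h5, h4, add_zero]
  exact h2

end ScalarModulo

/-! ### Inertial endomorphisms on torsion elements -/

section Inertial

variable {A : Type*} [AddCommGroup A] {γ : A →+ A}

theorem AddSubgroup.mk_addSubgroupOf_sup_eq_iff {H K : AddSubgroup A} (x y : ↥(H ⊔ K)) :
    (QuotientAddGroup.mk x : ↥(H ⊔ K) ⧸ H.addSubgroupOf (H ⊔ K)) = QuotientAddGroup.mk y ↔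
      (y - x : A) ∈ H := by
  rw [QuotientAddGroup.eq, AddSubgroup.mem_addSubgroupOf]
  simp [neg_add_eq_sub]

theorem IsInertial.exists_lt_sub_mem (h : IsInertial γ) (H : AddSubgroup A) {a : ℕ → A}
    (ha : ∀ n, a n ∈ H) : ∃ m n, m < n ∧ γ (a n) - γ (a m) ∈ H := by
  have := h H
  let f : ℕ → ↥(H ⊔ H.map γ) ⧸ H.addSubgroupOf (H ⊔ H.map γ) := fun n =>
    QuotientAddGroup.mk ⟨γ (a n), AddSubgroup.mem_sup_right (AddSubgroup.mem_map_of_mem γ (ha n))⟩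
  obtain ⟨m, n, hmn, hf⟩ := Finite.exists_ne_map_eq_of_infinite f
  rcases hmn.lt_or_gt with hlt | hlt
  · exact ⟨m, n, hlt, (AddSubgroup.mk_addSubgroupOf_sup_eq_iff _ _).1 hf⟩
  · exact ⟨n, m, hlt, (AddSubgroup.mk_addSubgroupOf_sup_eq_iff _ _).1 hf.symm⟩

theorem IsInertial.exists_zsmul_mem (h : IsInertial γ) (H : AddSubgroup A) :
    ∃ q : ℤ, q ≠ 0 ∧ ∀ x ∈ H, q • γ x ∈ H := by
  have := h H
  set Q := ↥(H ⊔ H.map γ) ⧸ H.addSubgroupOf (H ⊔ H.map γ)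
  refine ⟨Nat.card Q, by exact_mod_cast Nat.card_pos.ne', fun x hx => ?_⟩
  let y : ↥(H ⊔ H.map γ) := ⟨γ x, AddSubgroup.mem_sup_right (AddSubgroup.mem_map_of_mem γ hx)⟩
  have h1 : Nat.card Q • (QuotientAddGroup.mk y : Q) = 0 := card_nsmul_eq_zero'
  rw [← QuotientAddGroup.mk_nsmul, QuotientAddGroup.eq_zero_iff,
    AddSubgroup.mem_addSubgroupOf] at h1
  rw [natCast_zsmul]
  exact h1

theorem isInertial_of_finite_sup
    (h : ∀ H : AddSubgroup A, ∃ F : AddSubgroup A, Finite F ∧ H.map γ ≤ H ⊔ F) :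
    IsInertial γ := by
  intro H
  obtain ⟨F, hF, hHF⟩ := h H
  have key : ∀ q : ↥(H ⊔ H.map γ) ⧸ H.addSubgroupOf (H ⊔ H.map γ),
      ∃ f : F, ∃ x : ↥(H ⊔ H.map γ), q = QuotientAddGroup.mk x ∧ (x - f : A) ∈ H := by
    intro q
    induction q using QuotientAddGroup.induction_on with
    | H x =>
      have hx : (x : A) ∈ H ⊔ F := (sup_le le_sup_left hHF) x.2
      obtain ⟨y, hy, f, hf, hyf⟩ := AddSubgroup.mem_sup.1 hx
      exact ⟨⟨f, hf⟩, x, rfl, by rw [← hyf, add_sub_cancel_right]; exact hy⟩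
  choose f x hq hx using key
  refine Finite.of_injective f fun q r hqr => ?_
  rw [hq q, hq r, AddSubgroup.mk_addSubgroupOf_sup_eq_iff]
  have := H.sub_mem (hx r) (hx q)
  rwa [hqr, sub_sub_sub_cancel_right] at this

/-- Otherwise each finite F has a bad element. Enlarging F by that element and its image, again and
again, gives independent bad elements c_n. By inertiality some γ c_n - γ c_m with m < n lies in the
subgroup H they generate, which puts γ c_n in ⟨c_n⟩ + F_n, a contradiction. -/
theorem IsInertial.exists_finite_sub_mem (h : IsInertial γ) :
    ∃ F : AddSubgroup A, Finite F ∧ ∀ a : A, IsOfFinAddOrder a →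
      (∀ m : ℤ, m • a ∈ F → m • a = 0) → ∃ m : ℤ, γ a - m • a ∈ F := by
  by_contra! hcon
  have hcon' : ∀ F : {F : AddSubgroup A // Finite F}, ∃ a : A, IsOfFinAddOrder a ∧
      (∀ m : ℤ, m • a ∈ F.1 → m • a = 0) ∧ ∀ m : ℤ, γ a - m • a ∉ F.1 := fun F => hcon F.1 F.2
  choose c hc havoid hbad using hcon'
  have hstep : ∀ F : {F : AddSubgroup A // Finite F},
      Finite ↥(F.1 ⊔ (AddSubgroup.zmultiples (c F) ⊔ AddSubgroup.zmultiples (γ (c F)))) := by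
    intro F
    have := F.2
    have := AddSubgroup.finite_zmultiples_of_isOfFinAddOrder (hc F)
    have := AddSubgroup.finite_zmultiples_of_isOfFinAddOrder (γ.isOfFinAddOrder (hc F))
    have := AddSubgroup.finite_sup_of_finite (AddSubgroup.zmultiples (c F))
      (AddSubgroup.zmultiples (γ (c F)))
    exact AddSubgroup.finite_sup_of_finite _ _
  let F : ℕ → {F : AddSubgroup A // Finite F} := fun n =>
    Nat.rec ⟨⊥, inferInstance⟩ (fun _ F => ⟨_, hstep F⟩) n
  have hF : ∀ n, (F (n + 1)).1 =
    (F n).1 ⊔ (AddSubgroup.zmultiples (c (F n)) ⊔ AddSubgroup.zmultiples (γ (c (F n)))) :=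
    fun n => rfl
  have hmono : Monotone fun n => (F n).1 := monotone_nat_of_le_succ fun n => by
    rw [hF]; exact le_sup_left
  have hcF : ∀ n, c (F n) ∈ (F (n + 1)).1 := fun n => by
    rw [hF]
    exact AddSubgroup.mem_sup_right (AddSubgroup.mem_sup_left (AddSubgroup.mem_zmultiples _))
  have hγF : ∀ n, γ (c (F n)) ∈ (F (n + 1)).1 := fun n => by
    rw [hF]
    exact AddSubgroup.mem_sup_right (AddSubgroup.mem_sup_right (AddSubgroup.mem_zmultiples _))
  let H : ℕ → AddSubgroup A := fun n =>
    Nat.rec ⊥ (fun n H => H ⊔ AddSubgroup.zmultiples (c (F n))) n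
  have hH : ∀ n, H (n + 1) = H n ⊔ AddSubgroup.zmultiples (c (F n)) := fun n => rfl
  have hHmono : Monotone H := monotone_nat_of_le_succ fun n => by
    rw [hH]; exact le_sup_left
  have hHF : ∀ n, H n ≤ (F n).1 := fun n => by
    induction n with
    | zero => exact bot_le
    | succ n ih =>
      rw [hH]
      refine sup_le (ih.trans (hmono n.le_succ)) ?_
      rw [AddSubgroup.zmultiples_le]
      exact hcF n
  -- Independence: elements of H lying in F_n need only the generators chosen before stage n.
  have hdesc : ∀ n d x, x ∈ H (n + d) → x ∈ (F n).1 → x ∈ H n := fun n d => by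
    induction d with
    | zero => exact fun x hx _ => hx
    | succ d ih =>
      intro x hx hxF
      rw [← add_assoc, hH] at hx
      obtain ⟨y, hy, z, hz, rfl⟩ := AddSubgroup.mem_sup.1 hx
      obtain ⟨m, rfl⟩ := AddSubgroup.mem_zmultiples_iff.1 hz
      have h1 : m • c (F (n + d)) ∈ (F (n + d)).1 := by
        have := (F (n + d)).1.sub_mem (hmono (Nat.le_add_right n d) hxF) (hHF _ hy)
        rwa [add_sub_cancel_left] at this
      rw [havoid _ m h1, add_zero] at hxF ⊢
      exact ih y hy hxF
  obtain ⟨m, n, hmn, hmem⟩ := h.exists_lt_sub_mem (⨆ n, H n) (a := fun n => c (F n)) fun n =>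
    AddSubgroup.mem_iSup_of_mem (n + 1) (by
      rw [hH]; exact AddSubgroup.mem_sup_right (AddSubgroup.mem_zmultiples _))
  have hm : γ (c (F m)) ∈ (F n).1 := hmono hmn (hγF m)
  obtain ⟨N, hN⟩ := (AddSubgroup.mem_iSup_of_directed hHmono.directed_le).1 hmem
  have h1 : γ (c (F n)) - γ (c (F m)) ∈ H (n + 1) :=
    hdesc (n + 1) N _ (hHmono (by omega) hN)
      ((F (n + 1)).1.sub_mem (hγF n) (hmono n.le_succ hm))
  rw [hH] at h1
  obtain ⟨y, hy, z, hz, hyz⟩ := AddSubgroup.mem_sup.1 h1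
  obtain ⟨k, rfl⟩ := AddSubgroup.mem_zmultiples_iff.1 hz
  apply hbad (F n) k
  have := (F n).1.add_mem (hHF n hy) hm
  convert this using 1
  rw [sub_eq_iff_eq_add]
  rw [eq_comm, sub_eq_iff_eq_add] at hyz
  rw [hyz]
  abel

/-- Successive division by p places a in a quasicyclic group. Inertiality keeps γ a inside it, and
there an element whose order divides that of a lies in ⟨a⟩. -/
theorem IsInertial.apply_mem_zmultiples_of_divisible {p : ℕ} (hp : p.Prime) (h : IsInertial γ)
    {D : AddSubgroup A} (hD : D ≤ pTorsion A p) (hdiv : ∀ a ∈ D, ∃ b ∈ D, (p : ℤ) • b = a)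
    {a : A} (ha : a ∈ D) : ∃ m : ℤ, γ a = m • a := by
  by_cases ha0 : a = 0
  · exact ⟨0, by simp [ha0]⟩
  have hp0 : (p : ℤ) ≠ 0 := by exact_mod_cast hp.ne_zero
  choose! f hfD hf using hdiv
  let c : ℕ → A := fun n => f^[n] a
  have hc : ∀ n, c n ∈ D := fun n => by
    induction n with
    | zero => exact ha
    | succ n ih => simp only [c, Function.iterate_succ_apply']; exact hfD _ ih
  have hcs : ∀ n k, (p : ℤ) ^ k • c (n + k) = c n := fun n k => by
    induction k with
    | zero => simp
    | succ k ih =>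
      have : (p : ℤ) • c (n + k + 1) = c (n + k) := by
        simp only [c, Function.iterate_succ_apply']
        exact hf _ (hc (n + k))
      rw [pow_succ, mul_smul, ← add_assoc, this, ih]
  have hmono : Monotone fun n => AddSubgroup.zmultiples (c n) := monotone_nat_of_le_succ fun n => by
    rw [AddSubgroup.zmultiples_le, AddSubgroup.mem_zmultiples_iff]
    exact ⟨p, by simpa using hcs n 1⟩
  obtain ⟨q, hq0, hq⟩ := h.exists_zsmul_mem (⨆ n, AddSubgroup.zmultiples (c n))
  obtain ⟨i, q', hq', rfl⟩ : ∃ (i : ℕ) (q' : ℤ), ¬ (p : ℤ) ∣ q' ∧ q = (p : ℤ) ^ i * q' := by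
    have hfin : FiniteMultiplicity (p : ℤ) q :=
      Int.finiteMultiplicity_iff.2 ⟨by simpa using hp.one_lt.ne', hq0⟩
    obtain ⟨q', h1, h2⟩ := hfin.exists_eq_pow_mul_and_not_dvd
    exact ⟨_, q', h2, h1⟩
  -- Write q = p^i q'. The factor p^i is absorbed by starting from c_i, since p^i c_i = a, and q' is
  -- invertible on p-elements.
  have hγ : γ a ∈ ⨆ n, AddSubgroup.zmultiples (c n) := by
    have h1 := hq (c i) (AddSubgroup.mem_iSup_of_mem i (AddSubgroup.mem_zmultiples _))
    have h2 : (p : ℤ) ^ i • c i = a := by simpa [c] using hcs 0 i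
    rw [mul_comm, mul_smul, ← map_zsmul, h2] at h1
    obtain ⟨s, hs⟩ := map_mem_pTorsion γ (hD ha)
    obtain ⟨r, hr⟩ := exists_mul_smul_eq_self hs (m := q')
      ((((Nat.prime_iff_prime_int.1 hp).coprime_iff_not_dvd.2 hq').symm).pow_right)
    rw [← hr, mul_smul]
    exact AddSubgroup.zsmul_mem _ h1 r
  obtain ⟨k, hk⟩ := (AddSubgroup.mem_iSup_of_directed hmono.directed_le).1 hγ
  obtain ⟨m, hm⟩ := AddSubgroup.mem_zmultiples_iff.1 hk
  have hex : ∃ s : ℕ, (p : ℤ) ^ s • a = 0 := hD ha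
  classical
  obtain ⟨j, hj⟩ : ∃ j, Nat.find hex = j + 1 := Nat.exists_eq_succ_of_ne_zero fun h0 => by
    have := Nat.find_spec hex
    rw [h0, pow_zero, one_smul] at this
    exact ha0 this
  have hj0 : (p : ℤ) ^ j • a ≠ 0 := Nat.find_min hex (by omega)
  have hj1 : (p : ℤ) ^ (j + 1) • a = 0 := hj ▸ Nat.find_spec hex
  have hck : (p : ℤ) ^ k • c k = a := by simpa [c] using hcs 0 k
  have h1 : ((p : ℤ) ^ (j + 1) * m) • c k = 0 := by
    rw [mul_smul, hm, ← map_zsmul, hj1, map_zero]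
  have h2 : (p : ℤ) ^ (j + k) • c k ≠ 0 := by rwa [pow_add, mul_smul, hck]
  have h3 := pow_succ_dvd_of_smul_eq_zero hp (hD (hc k)) h2 h1
  rw [add_right_comm, pow_add] at h3
  obtain ⟨e, rfl⟩ := Int.dvd_of_mul_dvd_mul_left (pow_ne_zero _ hp0) h3
  exact ⟨e, by rw [← hm, mul_comm, mul_smul, hck]⟩

end Inertial

/-! ### Passing from generators to the generated group -/

section Closure

variable {A : Type*} [AddCommGroup A] {S : Set (Multiplicative (AddAut A))}

theorem exists_inv_apply_eq_zsmul {g : Multiplicative (AddAut A)} {a : A} (ha : IsOfFinAddOrder a)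
    (h : ∃ m : ℤ, toAdd g a = m • a) : ∃ m : ℤ, toAdd g⁻¹ a = m • a := by
  obtain ⟨m, hm⟩ := h
  have := AddSubgroup.finite_zmultiples_of_isOfFinAddOrder ha
  let f : AddSubgroup.zmultiples a → AddSubgroup.zmultiples a := fun x => ⟨toAdd g x, by
    obtain ⟨k, hk⟩ := AddSubgroup.mem_zmultiples_iff.1 x.2
    rw [← hk, map_zsmul, hm]
    exact AddSubgroup.zsmul_mem _ (AddSubgroup.zsmul_mem _ (AddSubgroup.mem_zmultiples a) _) _⟩
  have hf : Function.Injective f := fun x y hxy =>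
    Subtype.ext ((toAdd g).injective (congrArg Subtype.val hxy))
  obtain ⟨x, hx⟩ := Finite.injective_iff_surjective.1 hf ⟨a, AddSubgroup.mem_zmultiples a⟩
  obtain ⟨k, hk⟩ := AddSubgroup.mem_zmultiples_iff.1 x.2
  refine ⟨k, ?_⟩
  have hx' : toAdd g x = a := congrArg Subtype.val hx
  rw [hk]
  exact (AddEquiv.symm_apply_eq (toAdd g)).2 hx'.symm

theorem exists_apply_eq_zsmul_of_mem_closure {D : AddSubgroup A} (hD : ∀ a ∈ D, IsOfFinAddOrder a)
    (h : ∀ γ ∈ S, ∀ a ∈ D, ∃ m : ℤ, toAdd γ a = m • a) {g : Multiplicative (AddAut A)}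
    (hg : g ∈ Subgroup.closure S) : ∀ a ∈ D, ∃ m : ℤ, toAdd g a = m • a := by
  induction hg using Subgroup.closure_induction with
  | mem γ hγ => exact h γ hγ
  | one => exact fun a _ => ⟨1, (one_smul ℤ a).symm⟩
  | mul x y _ _ hx hy =>
    intro a ha
    obtain ⟨m, hm⟩ := hy a ha
    obtain ⟨n, hn⟩ := hx a ha
    refine ⟨m * n, ?_⟩
    change toAdd x (toAdd y a) = _
    rw [hm, map_zsmul, hn, mul_smul]
  | inv x _ hx => exact fun a ha => exists_inv_apply_eq_zsmul (hD a ha) (hx a ha)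

theorem exists_scalar_of_mem_closure {p : ℕ} (hp : p.Prime) {U : AddSubgroup A}
    (h : ∀ γ ∈ S, ∀ n : ℕ, ∃ m : ℤ, ∀ w ∈ U, (p : ℤ) ^ n • w = 0 → toAdd γ w = m • w)
    {g : Multiplicative (AddAut A)} (hg : g ∈ Subgroup.closure S) :
    ∀ n : ℕ, ∃ m : ℤ, ∀ w ∈ U, (p : ℤ) ^ n • w = 0 → toAdd g w = m • w := by
  induction hg using Subgroup.closure_induction with
  | mem γ hγ => exact h γ hγ
  | one => exact fun n => ⟨1, fun w _ _ => (one_smul ℤ w).symm⟩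
  | mul x y _ _ hx hy =>
    intro n
    obtain ⟨k, hk⟩ := hx n
    obtain ⟨l, hl⟩ := hy n
    refine ⟨l * k, fun w hw hn => ?_⟩
    change toAdd x (toAdd y w) = _
    rw [hl w hw hn, map_zsmul, hk w hw hn, mul_smul]
  | inv x _ hx =>
    intro n
    obtain ⟨m, hm⟩ := hx n
    -- If p divides m, injectivity of x leaves only w = 0; otherwise invert m modulo p^n.
    by_cases hpm : (p : ℤ) ∣ m
    · obtain ⟨e, rfl⟩ := hpm
      refine ⟨0, fun w hw hn => ?_⟩
      have key : ∀ k : ℕ, (p : ℤ) ^ k • w = 0 → w = 0 := fun k => by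
        induction k with
        | zero => intro h0; simpa using h0
        | succ k ih =>
          intro hk
          apply ih
          apply (toAdd x).injective
          rw [map_zero, hm _ (U.zsmul_mem hw _) (by rw [smul_comm, hn, smul_zero]), ← mul_smul,
            mul_right_comm, ← pow_succ', mul_comm, mul_smul, hk, smul_zero]
      rw [key n hn, map_zero, smul_zero]
    · obtain ⟨u, v, huv⟩ : IsCoprime m ((p : ℤ) ^ n) :=
        (((Nat.prime_iff_prime_int.1 hp).coprime_iff_not_dvd.2 hpm).symm).pow_right
      refine ⟨u, fun w hw hn => ?_⟩
      refine (AddEquiv.symm_apply_eq (toAdd x)).2 ?_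
      have : (u * m + v * (p : ℤ) ^ n) • w = w := by rw [huv, one_smul]
      rw [add_smul, mul_smul v, hn, smul_zero, add_zero, mul_smul] at this
      rw [map_zsmul, hm w hw hn, this]

end Closure

/-! ### Finite invariant supplements -/

section CosetFinite

variable {A : Type*} [AddCommGroup A]

/-- `B` is covered by finitely many cosets of `U` with representatives in `B`. -/
def IsCosetFinite (U B : AddSubgroup A) : Prop :=
  ∃ X : Set A, X.Finite ∧ (∀ x ∈ X, x ∈ B) ∧ ∀ b ∈ B, ∃ x ∈ X, b - x ∈ U

theorem IsCosetFinite.of_finite_image {U B : AddSubgroup A} {β : Type*} (f : A → β)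
    (hf : (f '' (B : Set A)).Finite)
    (h : ∀ b ∈ B, ∀ b' ∈ B, f b = f b' → b - b' ∈ U) : IsCosetFinite U B := by
  obtain ⟨X, hXB, hX⟩ := (Set.surjOn_image f (B : Set A)).exists_bijOn_subset
  refine ⟨X, ?_, fun x hx => hXB hx, fun b hb => ?_⟩
  · exact Set.Finite.of_finite_image (hX.image_eq ▸ hf) hX.injOn
  · obtain ⟨x, hx, hxb⟩ := hX.surjOn ⟨b, hb, rfl⟩
    exact ⟨x, hx, h b hb x (hXB hx) hxb.symm⟩

theorem IsCosetFinite.trans {U V B : AddSubgroup A} (hUV : IsCosetFinite U V)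
    (hVB : IsCosetFinite V B) (hle : V ≤ B) : IsCosetFinite U B := by
  obtain ⟨X, hX, hXV, hXU⟩ := hUV
  obtain ⟨Y, hY, hYB, hYV⟩ := hVB
  refine ⟨Set.image2 (fun x y => x + y) X Y, hX.image2 _ hY, ?_, fun b hb => ?_⟩
  · rintro _ ⟨x, hx, y, hy, rfl⟩
    exact B.add_mem (hle (hXV x hx)) (hYB y hy)
  · obtain ⟨y, hy, hby⟩ := hYV b hb
    obtain ⟨x, hx, hbx⟩ := hXU _ hby
    exact ⟨x + y, ⟨x, hx, y, hy, rfl⟩, by rwa [sub_sub, add_comm y x] at hbx⟩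

/-- Close up the coset representatives and y by adding the errors made when S moves them. The errors
lie in U, where S acts by multiples, so one round is enough. -/
theorem IsCosetFinite.exists_finite_invariant {U B : AddSubgroup A} (h : IsCosetFinite U B)
    (hUB : U ≤ B) (hB : ∀ b ∈ B, IsOfFinAddOrder b) {S : Set (Multiplicative (AddAut A))}
    (hS : S.Finite) (hSB : ∀ γ ∈ S, ∀ b ∈ B, toAdd γ b ∈ B)
    (hSU : ∀ γ ∈ S, ∀ u ∈ U, ∃ m : ℤ, toAdd γ u = m • u) {y : A} (hy : y ∈ B) :
    ∃ X : AddSubgroup A, Finite X ∧ X ≤ B ∧ y ∈ X ∧ (∀ γ ∈ S, ∀ x ∈ X, toAdd γ x ∈ X) ∧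
      ∀ b ∈ B, ∃ u ∈ U, ∃ x ∈ X, b = u + x := by
  obtain ⟨X₀, hX₀, hX₀B, hX₀U⟩ := h
  choose! r hr hrU using hX₀U
  let X₁ : Set A := insert y X₀
  have hX₁B : ∀ x ∈ X₁, x ∈ B := by
    rintro x (rfl | hx)
    exacts [hy, hX₀B x hx]
  let W : Set A := Set.image2 (fun (γ : Multiplicative (AddAut A)) x =>
    toAdd γ x - r (toAdd γ x)) S X₁
  have hWU : ∀ w ∈ W, w ∈ U := by
    rintro _ ⟨γ, hγ, x, hx, rfl⟩
    exact hrU _ (hSB γ hγ x (hX₁B x hx))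
  have hfin : (X₁ ∪ W).Finite := (hX₀.insert y).union (hS.image2 _ (hX₀.insert y))
  have hXB : ∀ x ∈ X₁ ∪ W, x ∈ B := by
    rintro x (hx | hx)
    exacts [hX₁B x hx, hUB (hWU x hx)]
  refine ⟨AddSubgroup.closure (X₁ ∪ W),
    AddSubgroup.finite_closure_of_isOfFinAddOrder hfin fun x hx => hB x (hXB x hx),
    (AddSubgroup.closure_le _).2 hXB, AddSubgroup.subset_closure (Or.inl (Or.inl rfl)), ?_, ?_⟩
  · intro γ hγ
    suffices AddSubgroup.closure (X₁ ∪ W) ≤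
        (AddSubgroup.closure (X₁ ∪ W)).comap (AddEquiv.toAddMonoidHom (toAdd γ)) from
      fun x hx => this hx
    refine (AddSubgroup.closure_le _).2 ?_
    rintro x (hx | hx)
    · change toAdd γ x ∈ AddSubgroup.closure (X₁ ∪ W)
      rw [← sub_add_cancel (toAdd γ x) (r (toAdd γ x))]
      exact AddSubgroup.add_mem _ (AddSubgroup.subset_closure (Or.inr ⟨γ, hγ, x, hx, rfl⟩))
        (AddSubgroup.subset_closure (Or.inl (Or.inr (hr _ (hSB γ hγ x (hX₁B x hx))))))
    · change toAdd γ x ∈ AddSubgroup.closure (X₁ ∪ W)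
      obtain ⟨m, hm⟩ := hSU γ hγ x (hWU x hx)
      rw [hm]
      have hx' : x ∈ AddSubgroup.closure (X₁ ∪ W) := AddSubgroup.subset_closure (Or.inr hx)
      exact AddSubgroup.zsmul_mem _ hx' m
  · intro b hb
    exact ⟨b - r b, hrU b hb, r b, AddSubgroup.subset_closure (Or.inl (Or.inr (hr b hb))),
      (sub_add_cancel b (r b)).symm⟩

end CosetFinite

/-! ### The p-component when some socle is finite -/

section PrimaryStructure

variable {A : Type*} [AddCommGroup A] {p : ℕ}

/-- The subgroup of the elements killed by `p ^ n`. -/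
def powTorsion (A : Type*) [AddCommGroup A] (p n : ℕ) : AddSubgroup A :=
  (zsmulAddGroupHom ((p : ℤ) ^ n) : A →+ A).ker

theorem mem_powTorsion {n : ℕ} {a : A} : a ∈ powTorsion A p n ↔ (p : ℤ) ^ n • a = 0 := Iff.rfl

theorem powTorsion_le_pTorsion (n : ℕ) : powTorsion A p n ≤ pTorsion A p := fun _ ha => ⟨n, ha⟩

theorem powTorsion_mono {k n : ℕ} (h : k ≤ n) : powTorsion A p k ≤ powTorsion A p n :=
  fun _ ha => pow_smul_eq_zero_of_le h ha

theorem finite_pow_smul_powTorsion {K : ℕ} (hK : (pSocle A p K).Finite) (n : ℕ) :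
    {x : A | (p : ℤ) ^ n • x = 0 ∧ ∃ c : A, (p : ℤ) ^ K • c = x}.Finite := by
  induction n with
  | zero =>
    refine (Set.finite_singleton (0 : A)).subset ?_
    rintro x ⟨hx, -⟩
    simpa using hx
  | succ n ih =>
    refine Set.Finite.of_finite_fibers (fun x => (p : ℤ) • x) (ih.subset ?_) ?_
    · rintro _ ⟨x, ⟨hx, c, rfl⟩, rfl⟩
      exact ⟨by rwa [← mul_smul, ← pow_succ], (p : ℤ) • c, smul_comm _ _ _⟩
    · rintro _ ⟨x, ⟨hx, c, rfl⟩, rfl⟩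
      refine (hK.image fun y => y + (p : ℤ) ^ K • c).subset ?_
      rintro y ⟨⟨hy, d, rfl⟩, hyx⟩
      refine ⟨(p : ℤ) ^ K • d - (p : ℤ) ^ K • c, ⟨?_, d - c, by rw [smul_sub]⟩, sub_add_cancel _ _⟩
      rw [smul_sub, sub_eq_zero]
      exact hyx

theorem isCosetFinite_powTorsion {K : ℕ} (hK : (pSocle A p K).Finite) (n : ℕ) :
    IsCosetFinite (powTorsion A p K) (powTorsion A p n) := by
  refine IsCosetFinite.of_finite_image (fun x => (p : ℤ) ^ K • x)
    ((finite_pow_smul_powTorsion hK n).subset ?_) ?_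
  · rintro _ ⟨x, hx, rfl⟩
    exact ⟨by rw [smul_comm, mem_powTorsion.1 hx, smul_zero], x, rfl⟩
  · intro b _ b' _ h
    rw [mem_powTorsion, smul_sub, sub_eq_zero]
    exact h

/-- The decreasing socles are finite from K on, hence constant from some N. Subtracting a deeper
element with the same bottom multiple lowers the order, which allows induction. -/
theorem exists_pow_divisible {K : ℕ} (hK : (pSocle A p K).Finite) :
    ∃ N, K ≤ N ∧ ∀ x ∈ pTorsion A p, (∃ c, (p : ℤ) ^ N • c = x) →
      ∃ c, (p : ℤ) ^ (N + 1) • c = x := by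
  obtain ⟨N, hN, hmin⟩ : ∃ N, K ≤ N ∧ ∀ n, N ≤ n → pSocle A p n = pSocle A p N := by
    obtain ⟨N, hN, hmin⟩ := WellFounded.has_min (measure fun n => (pSocle A p n).ncard).wf
      (Set.Ici K) ⟨K, Set.self_mem_Ici⟩
    refine ⟨N, hN, fun n hn => ?_⟩
    exact Set.eq_of_subset_of_ncard_le (pSocle_antitone hn)
      (not_lt.1 (hmin n (le_trans hN hn))) (hK.subset (pSocle_antitone hN))
  refine ⟨N, hN, ?_⟩
  rintro x ⟨j, hj⟩
  induction j generalizing x with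
  | zero => exact fun _ => ⟨0, by simpa using hj.symm⟩
  | succ j ih =>
    rintro ⟨c, rfl⟩
    have h1 : (p : ℤ) ^ j • (p : ℤ) ^ N • c ∈ pSocle A p (N + 1 + j) := by
      rw [hmin _ (by omega)]
      exact ⟨by rwa [← mul_smul, ← pow_succ'], (p : ℤ) ^ j • c, smul_comm _ _ _⟩
    obtain ⟨-, y, hy⟩ := h1
    obtain ⟨z, hz⟩ := ih ((p : ℤ) ^ N • c - (p : ℤ) ^ (N + 1) • y)
      (by rw [smul_sub, ← hy, ← mul_smul, ← pow_add, add_comm j, sub_self])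
      ⟨c - (p : ℤ) • y, by rw [smul_sub, ← mul_smul, ← pow_succ]⟩
    exact ⟨z + y, by rw [smul_add, hz, sub_add_cancel]⟩

theorem exists_pow_smul_eq_zero_of_finite {X : AddSubgroup A} [Finite X]
    (hX : X ≤ pTorsion A p) : ∃ k : ℕ, ∀ x ∈ X, (p : ℤ) ^ k • x = 0 := by
  choose! f hf using hX
  obtain ⟨k, hk⟩ := ((Set.toFinite (X : Set A)).image f).bddAbove
  exact ⟨k, fun x hx => pow_smul_eq_zero_of_le (hk ⟨x, hx, rfl⟩) (hf hx)⟩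

theorem exists_mem_smul_eq_zero_of_bounded (hp : p.Prime) {U : AddSubgroup A} {K : ℕ}
    (hU : U ≤ powTorsion A p K) :
    ∃ u ∈ U, ∀ m : ℤ, m • u = 0 → ∀ w ∈ U, m • w = 0 := by
  classical
  have hex : ∃ j : ℕ, ∀ w ∈ U, (p : ℤ) ^ j • w = 0 := ⟨K, fun w hw => hU hw⟩
  rcases Nat.eq_zero_or_eq_succ_pred (Nat.find hex) with h0 | h0
  · refine ⟨0, U.zero_mem, fun m _ w hw => ?_⟩
    have := Nat.find_spec hex w hw
    rw [h0, pow_zero, one_smul] at this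
    rw [this, smul_zero]
  · have h1 := Nat.find_min hex (m := (Nat.find hex).pred) (by omega)
    push Not at h1
    obtain ⟨u, hu, hu0⟩ := h1
    refine ⟨u, hu, fun m hm w hw => ?_⟩
    obtain ⟨e, rfl⟩ := pow_succ_dvd_of_smul_eq_zero hp (powTorsion_le_pTorsion K (hU hu)) hu0 hm
    have := Nat.find_spec hex w hw
    rw [h0] at this
    rw [mul_comm, mul_smul, this, smul_zero]

end PrimaryStructure

/-! ### Finite invariant subgroups for one prime -/

section PrimaryCase

variable {A : Type*} [AddCommGroup A] {p : ℕ} {S : Set (Multiplicative (AddAut A))}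

/-- U collects the p-elements on which every γ in S is exactly its scalar. It has finitely many
cosets because the defects γ a - μ a lie in F and S is finite, so a finite X supplements it. -/
theorem exists_finite_invariant_of_infinite_pSocle (hp : p.Prime) (hS : S.Finite)
    {F : AddSubgroup A} [Finite F]
    (hF : ∀ γ ∈ S, IsPowerModulo p F (AddEquiv.toAddMonoidHom (toAdd γ)))
    (hinf : ∀ k, (pSocle A p k).Infinite) :
    ∃ X : AddSubgroup A, Finite X ∧ (∀ γ ∈ S, ∀ x ∈ X, toAdd γ x ∈ X) ∧
      ∀ g ∈ Subgroup.closure S, (∀ x ∈ X, toAdd g x = x) →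
        ∀ a ∈ pTorsion A p, ∃ m : ℤ, toAdd g a = m • a := by
  have hsc : ∀ γ ∈ S, ∀ k : ℕ, ∃ m : ℤ, ∀ w : A, (p : ℤ) ^ (k + 1) • w = 0 →
      toAdd γ w - m • w ∈ F := fun γ hγ k => (hF γ hγ).exists_scalar hp (hinf k)
  choose! μ hμ using hsc
  have hcompat : ∀ γ ∈ S, ∀ k l, k ≤ l → ∀ w : A, (p : ℤ) ^ (k + 1) • w = 0 →
      μ γ l • w = μ γ k • w := by
    intro γ hγ k l hkl w hw
    obtain ⟨c, hc, hcF⟩ := exists_pow_smul_notMem (hinf k) F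
    have h1 : (μ γ l - μ γ k) • c ∈ F := by
      convert F.sub_mem (hμ γ hγ k c hc)
        (hμ γ hγ l c (pow_smul_eq_zero_of_le (by omega) hc)) using 1
      module
    obtain ⟨e, he⟩ := pow_succ_dvd_of_smul_eq_zero hp ⟨_, hc⟩
      (fun h0 => hcF (h0 ▸ F.zero_mem)) (smul_eq_zero_of_pow_smul_notMem hp hc hcF h1)
    rw [← sub_eq_zero, ← sub_smul, he, mul_comm, mul_smul, hw, smul_zero]
  let U : AddSubgroup A :=
    { carrier := {w | w ∈ pTorsion A p ∧
        ∀ γ ∈ S, ∀ k, (p : ℤ) ^ (k + 1) • w = 0 → toAdd γ w = μ γ k • w}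
      zero_mem' := ⟨AddSubgroup.zero_mem _, fun γ _ k _ => by rw [map_zero, smul_zero]⟩
      add_mem' := by
        rintro a b ⟨ha, ha'⟩ ⟨hb, hb'⟩
        refine ⟨AddSubgroup.add_mem _ ha hb, fun γ hγ k hk => ?_⟩
        obtain ⟨i, hi⟩ := ha
        obtain ⟨j, hj⟩ := hb
        rw [← hcompat γ hγ k (k + i + j) (by omega) _ hk, map_add, smul_add,
          ha' γ hγ (k + i + j) (pow_smul_eq_zero_of_le (by omega) hi),
          hb' γ hγ (k + i + j) (pow_smul_eq_zero_of_le (by omega) hj)]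
      neg_mem' := by
        rintro a ⟨ha, ha'⟩
        refine ⟨AddSubgroup.neg_mem _ ha, fun γ hγ k hk => ?_⟩
        rw [map_neg, ha' γ hγ k (by rwa [smul_neg, neg_eq_zero] at hk), smul_neg] }
  have hUT : U ≤ pTorsion A p := fun w hw => hw.1
  have hUpow : ∀ γ ∈ S, ∀ u ∈ U, ∃ m : ℤ, toAdd γ u = m • u := by
    rintro γ hγ u ⟨⟨k, hk⟩, hu⟩
    exact ⟨μ γ k, hu γ hγ k (pow_smul_eq_zero_of_le k.le_succ hk)⟩
  have hcos : IsCosetFinite U (pTorsion A p) := by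
    have hex : ∀ a ∈ pTorsion A p, ∃ k : ℕ, (p : ℤ) ^ k • a = 0 := fun a ha => ha
    choose! e he using hex
    have := hS.to_subtype
    refine IsCosetFinite.of_finite_image
      (fun a (γ : S) => toAdd γ.1 a - μ γ.1 (e a) • a) ?_ ?_
    · refine (Set.Finite.pi' fun _ : S => Set.toFinite (F : Set A)).subset ?_
      rintro _ ⟨a, ha, rfl⟩ γ
      exact hμ γ.1 γ.2 _ a (pow_smul_eq_zero_of_le (Nat.le_succ _) (he a ha))
    · intro a ha b hb hab
      refine ⟨AddSubgroup.sub_mem _ ha hb, fun γ hγ k hk => ?_⟩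
      have h1 : toAdd γ a - μ γ (e a) • a = toAdd γ b - μ γ (e b) • b := congrFun hab ⟨γ, hγ⟩
      rw [← hcompat γ hγ (e a) (k + e a + e b) (by omega) a
          (pow_smul_eq_zero_of_le (Nat.le_succ _) (he a ha)),
        ← hcompat γ hγ (e b) (k + e a + e b) (by omega) b
          (pow_smul_eq_zero_of_le (Nat.le_succ _) (he b hb)), sub_eq_sub_iff_sub_eq_sub] at h1
      rw [← hcompat γ hγ k (k + e a + e b) (by omega) _ hk, map_sub, h1, smul_sub]
  obtain ⟨X, hX, hXT, -, hXS, hXU⟩ := hcos.exists_finite_invariant hUT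
    (fun b hb => isOfFinAddOrder_of_mem_pTorsion hp hb) hS
    (fun γ _ b hb => map_mem_pTorsion (AddEquiv.toAddMonoidHom (toAdd γ)) hb) hUpow
    (AddSubgroup.zero_mem _)
  obtain ⟨k, hk⟩ := exists_pow_smul_eq_zero_of_finite hXT
  -- This supplies u in U of order greater than the exponent of X. An element fixing u has scalar 1
  -- modulo that exponent, so its scalar also describes its identity action on X.
  obtain ⟨c, hc, hcX⟩ := exists_pow_smul_notMem (hinf k) X
  obtain ⟨u, hu, x, hx, rfl⟩ := hXU c ⟨_, hc⟩
  have hu0 : (p : ℤ) ^ k • u ≠ 0 := fun h0 => hcX (by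
    rw [smul_add, h0, hk x hx, add_zero]
    exact X.zero_mem)
  have := AddSubgroup.finite_zmultiples_of_isOfFinAddOrder
    (isOfFinAddOrder_of_mem_pTorsion hp (hUT hu))
  refine ⟨X ⊔ AddSubgroup.zmultiples u, AddSubgroup.finite_sup_of_finite _ _, ?_, ?_⟩
  · intro γ hγ y hy
    obtain ⟨z, hz, v, hv, rfl⟩ := AddSubgroup.mem_sup.1 hy
    obtain ⟨n, rfl⟩ := AddSubgroup.mem_zmultiples_iff.1 hv
    obtain ⟨m, hm⟩ := hUpow γ hγ u hu
    rw [map_add, map_zsmul, hm]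
    exact AddSubgroup.add_mem _ (AddSubgroup.mem_sup_left (hXS γ hγ z hz))
      (AddSubgroup.mem_sup_right (AddSubgroup.zsmul_mem _ (AddSubgroup.zsmul_mem _
        (AddSubgroup.mem_zmultiples u) m) n))
  · intro g hg hgX a ha
    obtain ⟨w, hw, y, hy, rfl⟩ := hXU a ha
    obtain ⟨i, hi⟩ := hUT hw
    obtain ⟨j, hj⟩ := hUT hu
    obtain ⟨m, hm⟩ := exists_scalar_of_mem_closure hp (U := U)
      (fun γ hγ n => ⟨μ γ n, fun w hw hn => hw.2 γ hγ n (pow_smul_eq_zero_of_le n.le_succ hn)⟩)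
      hg (i + j)
    refine ⟨m, ?_⟩
    have h1 : toAdd g u = m • u := hm u hu (pow_smul_eq_zero_of_le (by omega) hj)
    rw [hgX u (AddSubgroup.mem_sup_right (AddSubgroup.mem_zmultiples u))] at h1
    have h2 : (m - 1) • u = 0 := by rw [sub_smul, ← h1, one_smul, sub_self]
    obtain ⟨e, he⟩ := pow_succ_dvd_of_smul_eq_zero hp (hUT hu) hu0 h2
    have h3 : (m - 1) • y = 0 := by
      rw [he, mul_comm, mul_smul, pow_smul_eq_zero_of_le k.le_succ (hk y hy), smul_zero]
    rw [sub_smul, one_smul, sub_eq_zero] at h3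
    rw [map_add, hm w hw (pow_smul_eq_zero_of_le (by omega) hi),
      hgX y (AddSubgroup.mem_sup_left hy), smul_add, h3]

/-- An element fixing X fixes some u of maximal order in U, hence all of U, hence everything killed
by p^N. The rest of the p-component comes from the divisible subgroup D. -/
theorem exists_finite_invariant_of_finite_pSocle (hp : p.Prime) (hS : S.Finite)
    (hin : ∀ γ ∈ S, IsInertial (AddEquiv.toAddMonoidHom (toAdd γ)))
    {F : AddSubgroup A} [Finite F]
    (hF : ∀ γ ∈ S, IsPowerModulo p F (AddEquiv.toAddMonoidHom (toAdd γ)))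
    (hfin : ∃ k, (pSocle A p k).Finite) :
    ∃ X : AddSubgroup A, Finite X ∧ (∀ γ ∈ S, ∀ x ∈ X, toAdd γ x ∈ X) ∧
      ∀ g ∈ Subgroup.closure S, (∀ x ∈ X, toAdd g x = x) →
        ∀ a ∈ pTorsion A p, ∃ m : ℤ, toAdd g a = m • a := by
  classical
  obtain ⟨K, hK, hKmin⟩ : ∃ K, (pSocle A p K).Finite ∧ ∀ k < K, (pSocle A p k).Infinite :=
    ⟨Nat.find hfin, Nat.find_spec hfin, fun k hk => Nat.find_min hfin hk⟩
  have hsc : ∀ γ ∈ S, ∃ m : ℤ, ∀ w : A, (p : ℤ) ^ K • w = 0 → toAdd γ w - m • w ∈ F := by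
    intro γ hγ
    -- Minimality of K makes the socle one level lower infinite, which is the level needed for
    -- p^K-torsion.
    rcases K with _ | K
    · refine ⟨0, fun w hw => ?_⟩
      rw [pow_zero, one_smul] at hw
      rw [hw, map_zero, smul_zero, sub_zero]
      exact F.zero_mem
    · exact (hF γ hγ).exists_scalar hp (hKmin K K.lt_succ_self)
  choose! μ hμ using hsc
  let U : AddSubgroup A :=
    { carrier := {w | w ∈ powTorsion A p K ∧ ∀ γ ∈ S, toAdd γ w = μ γ • w}
      zero_mem' := ⟨AddSubgroup.zero_mem _, fun γ _ => by rw [map_zero, smul_zero]⟩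
      add_mem' := by
        rintro a b ⟨ha, ha'⟩ ⟨hb, hb'⟩
        exact ⟨AddSubgroup.add_mem _ ha hb, fun γ hγ => by
          rw [map_add, smul_add, ha' γ hγ, hb' γ hγ]⟩
      neg_mem' := by
        rintro a ⟨ha, ha'⟩
        exact ⟨AddSubgroup.neg_mem _ ha, fun γ hγ => by rw [map_neg, ha' γ hγ, smul_neg]⟩ }
  have hUK : U ≤ powTorsion A p K := fun w hw => hw.1
  have hcos : IsCosetFinite U (powTorsion A p K) := by
    have := hS.to_subtype
    refine IsCosetFinite.of_finite_image (fun a (γ : S) => toAdd γ.1 a - μ γ.1 • a) ?_ ?_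
    · refine (Set.Finite.pi' fun _ : S => Set.toFinite (F : Set A)).subset ?_
      rintro _ ⟨a, ha, rfl⟩ γ
      exact hμ γ.1 γ.2 a ha
    · intro a ha b hb hab
      refine ⟨AddSubgroup.sub_mem _ ha hb, fun γ hγ => ?_⟩
      have h1 : toAdd γ a - μ γ • a = toAdd γ b - μ γ • b := congrFun hab ⟨γ, hγ⟩
      rw [sub_eq_sub_iff_sub_eq_sub] at h1
      rw [map_sub, h1, smul_sub]
  obtain ⟨N, hKN, hN⟩ := exists_pow_divisible hK
  have hUN : U ≤ powTorsion A p N := hUK.trans (powTorsion_mono hKN)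
  obtain ⟨u, hu, hu'⟩ := exists_mem_smul_eq_zero_of_bounded hp hUK
  obtain ⟨X, hX, hXN, huX, hXS, hXU⟩ :=
    (hcos.trans (isCosetFinite_powTorsion hK N) (powTorsion_mono hKN)).exists_finite_invariant hUN
      (fun b hb => isOfFinAddOrder_of_mem_pTorsion hp (powTorsion_le_pTorsion N hb)) hS
      (fun γ _ b hb => by rw [mem_powTorsion, ← map_zsmul, mem_powTorsion.1 hb, map_zero])
      (fun γ hγ w hw => ⟨μ γ, hw.2 γ hγ⟩) (hUN hu)
  let D : AddSubgroup A := pTorsion A p ⊓ (zsmulAddGroupHom ((p : ℤ) ^ N) : A →+ A).range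
  have hDT : D ≤ pTorsion A p := inf_le_left
  have hdiv : ∀ a ∈ D, ∃ b ∈ D, (p : ℤ) • b = a := by
    rintro a ⟨⟨j, hj⟩, c, hc⟩
    obtain ⟨y, rfl⟩ := hN a ⟨j, hj⟩ ⟨c, hc⟩
    refine ⟨(p : ℤ) ^ N • y, ⟨⟨j + 1, ?_⟩, y, rfl⟩, by rw [← mul_smul, ← pow_succ']⟩
    rw [← hj, pow_succ, mul_smul, ← mul_smul (p : ℤ), ← pow_succ']
  have hdiv' : ∀ n : ℕ, ∀ a ∈ D, ∃ b ∈ D, (p : ℤ) ^ n • b = a := by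
    intro n
    induction n with
    | zero => exact fun a ha => ⟨a, ha, by simp⟩
    | succ n ih =>
      intro a ha
      obtain ⟨b, hb, rfl⟩ := hdiv a ha
      obtain ⟨c, hc, rfl⟩ := ih b hb
      exact ⟨c, hc, by rw [pow_succ', mul_smul]⟩
  refine ⟨X, hX, hXS, fun g hg hgX a ha => ?_⟩
  have hgN : ∀ b ∈ powTorsion A p N, toAdd g b = b := by
    obtain ⟨m, hm⟩ := exists_scalar_of_mem_closure hp (U := U)
      (fun γ hγ _ => ⟨μ γ, fun w hw _ => hw.2 γ hγ⟩) hg K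
    have h1 : (m - 1) • u = 0 := by
      rw [sub_smul, ← hm u hu (hUK hu), hgX u huX, one_smul, sub_self]
    intro b hb
    obtain ⟨w, hw, x, hx, rfl⟩ := hXU b hb
    have h2 := hu' _ h1 w hw
    rw [sub_smul, one_smul, sub_eq_zero] at h2
    rw [map_add, hgX x hx, hm w hw (hUK hw), h2]
  obtain ⟨j, hj⟩ := ha
  obtain ⟨d, hd, hda⟩ := hdiv' N ((p : ℤ) ^ N • a)
    ⟨⟨j, by rw [smul_comm, hj, smul_zero]⟩, a, rfl⟩
  have hb : a - d ∈ powTorsion A p N := by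
    rw [mem_powTorsion, smul_sub, hda, sub_self]
  obtain ⟨m, hm⟩ := exists_apply_eq_zsmul_of_mem_closure
    (fun a ha => isOfFinAddOrder_of_mem_pTorsion hp (hDT ha))
    (fun γ hγ a ha => (hin γ hγ).apply_mem_zmultiples_of_divisible hp hDT hdiv ha) hg d hd
  suffices ∃ m : ℤ, toAdd g d = m • d ∧ m • (a - d) = a - d by
    obtain ⟨n, hn, hn'⟩ := this
    refine ⟨n, ?_⟩
    conv_lhs => rw [← sub_add_cancel a d]
    rw [map_add, hgN _ hb, hn, ← hn', ← smul_add, sub_add_cancel]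
  -- If p^N d ≠ 0, some multiple of d has order p^N and is fixed by g. Hence m is 1 modulo p^N, and
  -- m fixes a - d too.
  by_cases hdN : (p : ℤ) ^ N • d = 0
  · exact ⟨1, by rw [hgN d hdN, one_smul], one_smul _ _⟩
  · refine ⟨m, hm, ?_⟩
    have hex : ∃ r : ℕ, (p : ℤ) ^ r • d = 0 := hDT hd
    have hspec := Nat.find_spec hex
    have hNr : N < Nat.find hex := by
      by_contra! hle
      exact hdN (pow_smul_eq_zero_of_le hle hspec)
    obtain ⟨i, hi⟩ : ∃ i, Nat.find hex = i + 1 + N := ⟨Nat.find hex - N - 1, by omega⟩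
    rw [hi] at hspec
    have hmin := Nat.find_min hex (m := i + N) (by omega)
    have h1 := hgN ((p : ℤ) ^ (i + 1) • d) (by
      rw [mem_powTorsion, ← mul_smul, ← pow_add, add_comm N, hspec])
    rw [map_zsmul, hm] at h1
    have h2 : ((p : ℤ) ^ (i + 1) * (m - 1)) • d = 0 := by
      rw [mul_smul, sub_smul, one_smul, smul_sub, h1, sub_self]
    have h3 := pow_succ_dvd_of_smul_eq_zero hp (hDT hd) hmin h2
    rw [add_right_comm, pow_add] at h3
    obtain ⟨e, he⟩ := Int.dvd_of_mul_dvd_mul_left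
      (pow_ne_zero _ (by exact_mod_cast hp.ne_zero)) h3
    have h4 : (m - 1) • (a - d) = 0 := by
      rw [he, mul_comm, mul_smul, mem_powTorsion.1 hb, smul_zero]
    rwa [sub_smul, one_smul, sub_eq_zero] at h4

end PrimaryCase

/-! ### All primes together -/

section Torsion

variable {A : Type*} [AddCommGroup A]

theorem exists_apply_eq_zsmul_of_forall_prime {γ : A →+ A}
    (h : ∀ p : ℕ, p.Prime → ∀ a ∈ pTorsion A p, ∃ m : ℤ, γ a = m • a) {a : A}
    (ha : IsOfFinAddOrder a) : ∃ m : ℤ, γ a = m • a := by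
  obtain ⟨n, hn, hna⟩ := isOfFinAddOrder_iff_nsmul_eq_zero.1 ha
  rw [← natCast_zsmul] at hna
  induction n using Nat.recOnPosPrimePosCoprime generalizing a with
  | zero => exact absurd hn (lt_irrefl 0)
  | one =>
    refine ⟨0, ?_⟩
    rw [Nat.cast_one, one_smul] at hna
    rw [hna, map_zero, smul_zero]
  | prime_pow p n hp _ => exact h p hp a ⟨n, by exact_mod_cast hna⟩
  | coprime k l hk hl hkl ihk ihl =>
    obtain ⟨u, v, huv⟩ := Nat.isCoprime_iff_coprime.2 hkl
    have hfin : ∀ e : ℤ, IsOfFinAddOrder (e • a) := fun e => ha.zsmul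
    obtain ⟨m, hm⟩ := ihk (hfin (v * l)) (by omega) (by
      rw [← mul_smul, show (k : ℤ) * (v * l) = v * ((k * l : ℕ) : ℤ) by push_cast; ring, mul_smul,
        hna, smul_zero])
    obtain ⟨n, hn⟩ := ihl (hfin (u * k)) (by omega) (by
      rw [← mul_smul, show (l : ℤ) * (u * k) = u * ((k * l : ℕ) : ℤ) by push_cast; ring, mul_smul,
        hna, smul_zero])
    refine ⟨m * (v * l) + n * (u * k), ?_⟩
    have h1 : a = (v * l) • a + (u * k) • a := by rw [← add_smul, add_comm, huv, one_smul]
    conv_lhs => rw [h1]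
    rw [map_add, hm, hn, add_smul, mul_smul m, mul_smul n]

/-- For p not dividing |F| the p-component meets F trivially, so S already acts there by multiples.
Only finitely many primes contribute to X. -/
theorem exists_finite_invariant_apply_eq_zsmul {S : Set (Multiplicative (AddAut A))}
    (hS : S.Finite) (hin : ∀ γ ∈ S, IsInertial (AddEquiv.toAddMonoidHom (toAdd γ))) :
    ∃ X : AddSubgroup A, Finite X ∧ (∀ γ ∈ S, ∀ x ∈ X, toAdd γ x ∈ X) ∧
      ∀ g ∈ Subgroup.closure S, (∀ x ∈ X, toAdd g x = x) →
        ∀ a : A, IsOfFinAddOrder a → ∃ m : ℤ, toAdd g a = m • a := by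
  have hex := fun γ hγ => (hin γ hγ).exists_finite_sub_mem
  choose! E hE hEγ using hex
  set F := ⨆ γ ∈ S, E γ with hFdef
  have hFfin : Finite F := AddSubgroup.finite_biSup_of_finite hS E hE
  have hEF : ∀ γ ∈ S, E γ ≤ F := fun γ hγ => le_biSup E hγ
  have hF : ∀ γ ∈ S, ∀ a : A, IsOfFinAddOrder a → (∀ m : ℤ, m • a ∈ F → m • a = 0) →
      ∃ m : ℤ, toAdd γ a - m • a ∈ F := by
    intro γ hγ a ha h
    obtain ⟨m, hm⟩ := hEγ γ hγ a ha fun m hm => h m (hEF γ hγ hm)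
    exact ⟨m, hEF γ hγ hm⟩
  have hcard : Nat.card F ≠ 0 := Nat.card_pos.ne'
  have hgood : ∀ p : ℕ, p.Prime → ∃ X : AddSubgroup A, Finite X ∧
      (∀ γ ∈ S, ∀ x ∈ X, toAdd γ x ∈ X) ∧ ∀ g ∈ Subgroup.closure S, (∀ x ∈ X, toAdd g x = x) →
        ∀ a ∈ pTorsion A p, ∃ m : ℤ, toAdd g a = m • a := by
    intro p hp
    have hpow : ∀ γ ∈ S, IsPowerModulo p F (AddEquiv.toAddMonoidHom (toAdd γ)) :=
      fun γ hγ a ha h => hF γ hγ a (isOfFinAddOrder_of_mem_pTorsion hp ha) h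
    by_cases hfin : ∃ k, (pSocle A p k).Finite
    · exact exists_finite_invariant_of_finite_pSocle hp hS hin hpow hfin
    · exact exists_finite_invariant_of_infinite_pSocle hp hS hpow fun k hk => hfin ⟨k, hk⟩
  choose! X hX hXS hXp using hgood
  have hprime : ∀ p ∈ ((Nat.card F).primeFactors : Set ℕ), p.Prime := fun p hp =>
    Nat.prime_of_mem_primeFactors hp
  refine ⟨⨆ p ∈ ((Nat.card F).primeFactors : Set ℕ), X p,
    AddSubgroup.finite_biSup_of_finite (Finset.finite_toSet _) X fun p hp => hX p (hprime p hp),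
    ?_, ?_⟩
  · intro γ hγ
    suffices ⨆ p ∈ ((Nat.card F).primeFactors : Set ℕ), X p ≤
        (⨆ p ∈ ((Nat.card F).primeFactors : Set ℕ), X p).comap
          (AddEquiv.toAddMonoidHom (toAdd γ)) from fun x hx => this hx
    refine iSup₂_le fun p hp x hx => ?_
    exact le_biSup X hp (hXS p (hprime p hp) γ hγ x hx)
  · intro g hg hgX a ha
    refine exists_apply_eq_zsmul_of_forall_prime (γ := AddEquiv.toAddMonoidHom (toAdd g))
      (fun p hp => ?_) ha
    by_cases hpF : p ∣ Nat.card F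
    · have hpm : p ∈ ((Nat.card F).primeFactors : Set ℕ) :=
        Nat.mem_primeFactors.2 ⟨hp, hpF, hcard⟩
      exact hXp p hp g hg fun x hx => hgX x (le_biSup X hpm hx)
    · have hdisj : ∀ a ∈ pTorsion A p, a ∈ F → a = 0 := by
        rintro a ⟨k, hk⟩ haF
        have h1 : (Nat.card F : ℤ) • a = 0 := by
          rw [natCast_zsmul]
          have : Nat.card F • (⟨a, haF⟩ : F) = 0 := card_nsmul_eq_zero'
          exact congrArg Subtype.val this
        have hco : IsCoprime (Nat.card F : ℤ) ((p : ℤ) ^ k) :=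
          (Nat.isCoprime_iff_coprime.2 ((Nat.Prime.coprime_iff_not_dvd hp).2 hpF).symm).pow_right
        obtain ⟨r, hr⟩ := exists_mul_smul_eq_self hk hco
        rw [← hr, mul_smul, h1, smul_zero]
      refine exists_apply_eq_zsmul_of_mem_closure
        (fun a ha => isOfFinAddOrder_of_mem_pTorsion hp ha) (fun γ hγ a ha => ?_) hg
      obtain ⟨m, hm⟩ := hF γ hγ a (isOfFinAddOrder_of_mem_pTorsion hp ha) fun m hm =>
        hdisj _ (AddSubgroup.zsmul_mem _ ha m) hm
      refine ⟨m, ?_⟩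
      rw [← sub_eq_zero]
      exact hdisj _ (AddSubgroup.sub_mem _
        (map_mem_pTorsion (AddEquiv.toAddMonoidHom (toAdd γ)) ha)
        (AddSubgroup.zsmul_mem _ ha m)) hm

end Torsion

/-! ### The metabelian subgroup and its quotient -/

section Metabelian

open scoped commutatorElement

variable (A : Type*) [AddCommGroup A]

/-- The elements of `IAut(A)` that map each element of finite order to one of its multiples. -/
def torsionPowerSubgroup : Subgroup (IAut A) where
  carrier := {g | ∀ a : A, IsOfFinAddOrder a → ∃ m : ℤ, toAdd g.1 a = m • a}
  one_mem' := fun a _ => ⟨1, (one_smul ℤ a).symm⟩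
  mul_mem' := by
    intro x y hx hy a ha
    obtain ⟨m, hm⟩ := hy a ha
    obtain ⟨n, hn⟩ := hx a ha
    refine ⟨m * n, ?_⟩
    change toAdd x.1 (toAdd y.1 a) = _
    rw [hm, map_zsmul, hn, mul_smul]
  inv_mem' := fun {x} hx a ha => exists_inv_apply_eq_zsmul ha (hx a ha)

instance torsionPowerSubgroup_normal : (torsionPowerSubgroup A).Normal where
  conj_mem := by
    intro n hn g a ha
    obtain ⟨m, hm⟩ := hn (toAdd g⁻¹.1 a) (AddMonoidHom.isOfFinAddOrder
      (AddEquiv.toAddMonoidHom (toAdd g⁻¹.1)) ha)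
    refine ⟨m, ?_⟩
    change toAdd g.1 (toAdd n.1 (toAdd g⁻¹.1 a)) = _
    rw [hm, map_zsmul]
    exact congrArg _ (AddEquiv.apply_symm_apply (toAdd g.1) a)

variable {A}

theorem IsInertial.exists_zsmul_eq {γ : A →+ A} (h : IsInertial γ) (a : A) :
    ∃ n m : ℤ, n ≠ 0 ∧ n • γ a = m • a := by
  obtain ⟨q, hq, hqa⟩ := h.exists_zsmul_mem (AddSubgroup.zmultiples a)
  obtain ⟨m, hm⟩ := AddSubgroup.mem_zmultiples_iff.1 (hqa a (AddSubgroup.mem_zmultiples a))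
  exact ⟨q, m, hq, hm.symm⟩

theorem exists_zsmul_eq_of_mem_IAut {g : Multiplicative (AddAut A)} (hg : g ∈ IAut A) :
    ∀ a : A, ∃ n m : ℤ, n ≠ 0 ∧ n • toAdd g a = m • a := by
  induction hg using Subgroup.closure_induction with
  | mem γ hγ => exact fun a => IsInertial.exists_zsmul_eq hγ a
  | one => exact fun a => ⟨1, 1, one_ne_zero, rfl⟩
  | mul x y _ _ hx hy =>
    intro a
    obtain ⟨n, m, hn, hm⟩ := hy a
    obtain ⟨k, l, hk, hl⟩ := hx a
    refine ⟨n * k, m * l, mul_ne_zero hn hk, ?_⟩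
    change (n * k) • toAdd x (toAdd y a) = _
    rw [mul_comm, mul_smul, ← map_zsmul, hm, map_zsmul, smul_comm, hl, mul_smul]
  | inv x _ hx =>
    intro a
    obtain ⟨n, m, hn, hm⟩ := hx (toAdd x⁻¹ a)
    have hxa : toAdd x (toAdd x⁻¹ a) = a := AddEquiv.apply_symm_apply (toAdd x) a
    rw [hxa] at hm
    -- When m = 0, the integer n kills a and therefore its preimage.
    by_cases hm0 : m = 0
    · refine ⟨n, 0, hn, ?_⟩
      rw [← map_zsmul, hm, hm0, zero_smul, map_zero, zero_smul]
    · exact ⟨m, n, hm0, hm.symm⟩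

theorem mul_eq_commutator_mul {G : Type*} [Group G] (x y : G) : ⁅x, y⁆ * (y * x) = x * y := by
  rw [commutatorElement_def]; group

theorem apply_of_mem_commutator {g : torsionPowerSubgroup A}
    (hg : g ∈ commutator (torsionPowerSubgroup A)) (a : A) :
    IsOfFinAddOrder (toAdd g.1.1 a - a) ∧ (IsOfFinAddOrder a → toAdd g.1.1 a = a) := by
  rw [commutator_eq_closure] at hg
  induction hg using Subgroup.closure_induction generalizing a with
  | mem x hx =>
    obtain ⟨y, z, rfl⟩ := hx
    -- With a = z y b, the commutator sends a to y z b, so the two orders of composition are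
    -- compared at b.
    obtain ⟨b, hb⟩ : ∃ b, b = toAdd (z * y)⁻¹.1.1 a := ⟨_, rfl⟩
    have hba : toAdd z.1.1 (toAdd y.1.1 b) = a :=
      hb ▸ AddEquiv.apply_symm_apply (toAdd (z * y).1.1) a
    have hxa : toAdd ⁅y, z⁆.1.1 a = toAdd y.1.1 (toAdd z.1.1 b) := by
      rw [← hba]
      exact congrArg (fun g : torsionPowerSubgroup A => toAdd g.1.1 b) (mul_eq_commutator_mul y z)
    rw [hxa]
    constructor
    · obtain ⟨n, m, hn, hm⟩ := exists_zsmul_eq_of_mem_IAut y.1.2 b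
      obtain ⟨k, l, hk, hl⟩ := exists_zsmul_eq_of_mem_IAut z.1.2 b
      refine isOfFinAddOrder_of_zsmul_eq_zero (mul_ne_zero hn hk) ?_
      rw [smul_sub, sub_eq_zero, ← hba]
      calc (n * k) • toAdd y.1.1 (toAdd z.1.1 b)
          = (m * l) • b := by
            rw [mul_smul, ← map_zsmul, hl, map_zsmul, smul_comm, hm, ← mul_smul, mul_comm]
        _ = (n * k) • toAdd z.1.1 (toAdd y.1.1 b) := by
            rw [mul_comm n, mul_smul k, ← map_zsmul (toAdd z.1.1) n, hm, map_zsmul, smul_comm k, hl,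
              ← mul_smul]
    · intro ha
      have hbfin : IsOfFinAddOrder b := hb ▸
        AddMonoidHom.isOfFinAddOrder (AddEquiv.toAddMonoidHom (toAdd (z * y)⁻¹.1.1)) ha
      obtain ⟨m, hm⟩ := y.2 b hbfin
      obtain ⟨n, hn⟩ := z.2 b hbfin
      rw [← hba, hn, map_zsmul, hm, map_zsmul, hn, smul_comm]
  | one =>
    change IsOfFinAddOrder (a - a) ∧ (_ → a = a)
    exact ⟨by rw [sub_self]; exact IsOfFinAddOrder.zero, fun _ => rfl⟩
  | mul x y _ _ hx hy =>
    change IsOfFinAddOrder (toAdd x.1.1 (toAdd y.1.1 a) - a) ∧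
      (_ → toAdd x.1.1 (toAdd y.1.1 a) = a)
    refine ⟨?_, fun ha => by rw [(hy a).2 ha, (hx a).2 ha]⟩
    rw [← sub_add_sub_cancel _ (toAdd y.1.1 a)]
    exact (hx _).1.add (hy a).1
  | inv x _ hx =>
    have hxa : toAdd x.1.1 (toAdd x⁻¹.1.1 a) = a := AddEquiv.apply_symm_apply (toAdd x.1.1) a
    constructor
    · have := (hx (toAdd x⁻¹.1.1 a)).1.neg
      rwa [hxa, neg_sub] at this
    · intro ha
      exact (AddEquiv.symm_apply_eq (toAdd x.1.1)).2 ((hx a).2 ha).symm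

/-- Since y a - a is torsion, x fixes it; thus x y a = x a + y a - a, symmetric in x and y. -/
theorem isMetabelianGroup_torsionPowerSubgroup : IsMetabelianGroup (torsionPowerSubgroup A) := by
  intro x hx y hy
  refine Subtype.ext (Subtype.ext (toAdd.injective (AddEquiv.ext fun a => ?_)))
  change toAdd x.1.1 (toAdd y.1.1 a) = toAdd y.1.1 (toAdd x.1.1 a)
  have h1 := (apply_of_mem_commutator hx _).2 (apply_of_mem_commutator hy a).1
  have h2 := (apply_of_mem_commutator hy _).2 (apply_of_mem_commutator hx a).1
  rw [map_sub, sub_eq_iff_eq_add] at h1 h2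
  rw [h1, h2, sub_add_eq_add_sub, sub_add_eq_add_sub, add_comm]

theorem Subgroup.exists_finite_subset_of_mem_closure {G : Type*} [Group G] {s : Set G} {g : G}
    (hg : g ∈ Subgroup.closure s) : ∃ t ⊆ s, t.Finite ∧ g ∈ Subgroup.closure t := by
  induction hg using Subgroup.closure_induction with
  | mem x hx =>
    exact ⟨{x}, Set.singleton_subset_iff.2 hx, Set.finite_singleton x,
      Subgroup.subset_closure (Set.mem_singleton x)⟩
  | one => exact ⟨∅, Set.empty_subset _, Set.finite_empty, Subgroup.one_mem _⟩
  | mul x y _ _ hx hy =>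
    obtain ⟨t, hts, ht, hxt⟩ := hx
    obtain ⟨u, hus, hu, hyu⟩ := hy
    exact ⟨t ∪ u, Set.union_subset hts hus, ht.union hu, Subgroup.mul_mem _
      (Subgroup.closure_mono Set.subset_union_left hxt)
      (Subgroup.closure_mono Set.subset_union_right hyu)⟩
  | inv x _ hx =>
    obtain ⟨t, hts, ht, hxt⟩ := hx
    exact ⟨t, hts, ht, Subgroup.inv_mem _ hxt⟩

theorem apply_mem_of_mem_closure {S : Set (Multiplicative (AddAut A))} {X : AddSubgroup A}
    [Finite X] (hX : ∀ γ ∈ S, ∀ x ∈ X, toAdd γ x ∈ X) {g : Multiplicative (AddAut A)}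
    (hg : g ∈ Subgroup.closure S) : ∀ x ∈ X, toAdd g x ∈ X := by
  induction hg using Subgroup.closure_induction with
  | mem γ hγ => exact hX γ hγ
  | one => exact fun x hx => hx
  | mul x y _ _ hx hy => exact fun a ha => hx _ (hy a ha)
  | inv x _ hx =>
    intro a ha
    let f : X → X := fun y => ⟨toAdd x y, hx y y.2⟩
    have hf : Function.Injective f := fun y z hyz =>
      Subtype.ext ((toAdd x).injective (congrArg Subtype.val hyz))
    obtain ⟨y, hy⟩ := Finite.injective_iff_surjective.1 hf ⟨a, ha⟩
    have hy' : toAdd x y = a := congrArg Subtype.val hy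
    have : toAdd x⁻¹ a = y := (AddEquiv.symm_apply_eq (toAdd x)).2 hy'.symm
    rw [this]
    exact y.2

theorem isLocallyFiniteGroup_quotient_torsionPowerSubgroup :
    IsLocallyFiniteGroup (IAut A ⧸ torsionPowerSubgroup A) := by
  rintro H ⟨s, rfl⟩
  have hrep : ∀ q : IAut A ⧸ torsionPowerSubgroup A, ∃ t : Set (Multiplicative (AddAut A)),
      (∀ γ ∈ t, IsInertial (AddEquiv.toAddMonoidHom (toAdd γ))) ∧ t.Finite ∧
      ∃ g : IAut A, QuotientGroup.mk g = q ∧ g.1 ∈ Subgroup.closure t := by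
    intro q
    obtain ⟨g, rfl⟩ := QuotientGroup.mk_surjective q
    obtain ⟨t, hts, ht, hgt⟩ := Subgroup.exists_finite_subset_of_mem_closure g.2
    exact ⟨t, hts, ht, g, rfl, hgt⟩
  choose t htin ht g hg hgt using hrep
  set S := ⋃ q ∈ (s : Set (IAut A ⧸ torsionPowerSubgroup A)), t q with hSdef
  have hS : S.Finite := s.finite_toSet.biUnion fun q _ => ht q
  have hSin : ∀ γ ∈ S, IsInertial (AddEquiv.toAddMonoidHom (toAdd γ)) := by
    intro γ hγ
    obtain ⟨q, -, hq⟩ := Set.mem_iUnion₂.1 hγ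
    exact htin q γ hq
  obtain ⟨X, hX, hXS, hXpow⟩ := exists_finite_invariant_apply_eq_zsmul hS hSin
  let G : Subgroup (IAut A) := (Subgroup.closure S).subgroupOf (IAut A)
  have hle : Subgroup.closure (s : Set (IAut A ⧸ torsionPowerSubgroup A)) ≤
      G.map (QuotientGroup.mk' (torsionPowerSubgroup A)) := by
    refine (Subgroup.closure_le _).2 fun q hq => ⟨g q, ?_, hg q⟩
    exact Subgroup.closure_mono (Set.subset_biUnion_of_mem (u := t) hq) (hgt q)
  have hlift : ∀ q : Subgroup.closure (s : Set (IAut A ⧸ torsionPowerSubgroup A)),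
      ∃ x : IAut A, x.1 ∈ Subgroup.closure S ∧ QuotientGroup.mk x = q.1 := by
    intro q
    obtain ⟨x, hx, hxq⟩ := hle q.2
    exact ⟨x, hx, hxq⟩
  choose x hxS hxq using hlift
  -- Lifts agreeing on X differ by an element fixing X pointwise, hence lie in the same coset of Γ.
  refine Finite.of_injective (β := X → X)
    (fun q y => ⟨toAdd (x q).1 y, apply_mem_of_mem_closure hXS (hxS q) y y.2⟩) ?_
  intro q r hqr
  refine Subtype.ext ?_
  rw [← hxq q, ← hxq r, QuotientGroup.eq]
  refine hXpow _ (Subgroup.mul_mem _ (Subgroup.inv_mem _ (hxS q)) (hxS r)) fun y hy => ?_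
  have h1 : toAdd (x q).1 y = toAdd (x r).1 y := congrArg Subtype.val (congrFun hqr ⟨y, hy⟩)
  exact (AddEquiv.symm_apply_eq (toAdd (x q).1)).2 h1.symm

theorem isMetabelianByLocallyFinite_IAut : IsMetabelianByLocallyFinite (IAut A) :=
  ⟨torsionPowerSubgroup A, inferInstance, isMetabelianGroup_torsionPowerSubgroup,
    isLocallyFiniteGroup_quotient_torsionPowerSubgroup⟩

end Metabelian

/-! ### Divisibility of the Prüfer group -/

section Pruefer

variable {p : ℕ}

theorem PrueferGroup.mem_pTorsion (x : PrueferGroup p) : x ∈ pTorsion (PrueferGroup p) p := by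
  induction x using QuotientAddGroup.induction_on with
  | H q =>
    obtain ⟨m, k, hk⟩ := q.2
    refine ⟨k, ?_⟩
    rw [← QuotientAddGroup.mk_zsmul, QuotientAddGroup.eq_zero_iff, AddSubgroup.mem_addSubgroupOf,
      AddSubgroup.mem_zmultiples_iff]
    refine ⟨m, ?_⟩
    simp only [AddSubgroup.coe_zsmul, zsmul_eq_mul, mul_one]
    rw [← hk]
    push_cast
    ring

theorem PrueferGroup.exists_pow_smul_eq (hp : p.Prime) (k : ℕ) (x : PrueferGroup p) :
    ∃ y, (p : ℤ) ^ k • y = x := by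
  have hp0 : (p : ℚ) ≠ 0 := by exact_mod_cast hp.ne_zero
  induction x using QuotientAddGroup.induction_on with
  | H q =>
    obtain ⟨m, j, hj⟩ := q.2
    refine ⟨QuotientAddGroup.mk ⟨q.1 / (p : ℚ) ^ k, m, k + j, ?_⟩, ?_⟩
    · rw [pow_add, ← mul_assoc, div_mul_cancel₀ _ (pow_ne_zero _ hp0), hj]
    · rw [← QuotientAddGroup.mk_zsmul]
      congr 1
      refine Subtype.ext ?_
      simp only [AddSubgroup.coe_zsmul, zsmul_eq_mul]
      push_cast
      exact mul_div_cancel₀ _ (pow_ne_zero _ hp0)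

theorem PrueferGroup.exists_smul_eq (hp : p.Prime) {n : ℤ} (hn : n ≠ 0) (x : PrueferGroup p) :
    ∃ y, n • y = x := by
  have hfin : FiniteMultiplicity (p : ℤ) n :=
    Int.finiteMultiplicity_iff.2 ⟨by simpa using hp.one_lt.ne', hn⟩
  obtain ⟨q, h1, h2⟩ := hfin.exists_eq_pow_mul_and_not_dvd
  obtain ⟨k, hk⟩ := PrueferGroup.mem_pTorsion x
  obtain ⟨r, hr⟩ := exists_mul_smul_eq_self hk (m := q)
    (((Nat.prime_iff_prime_int.1 hp).coprime_iff_not_dvd.2 h2).symm).pow_right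
  obtain ⟨y, hy⟩ := PrueferGroup.exists_pow_smul_eq hp (multiplicity (p : ℤ) n) x
  refine ⟨r • y, ?_⟩
  rw [h1, mul_comm, mul_smul, smul_comm _ r, hy, ← mul_smul, mul_comm, hr]

theorem PrueferGroup.exists_ne_zero (hp : p.Prime) : ∃ x : PrueferGroup p, x ≠ 0 := by
  have hp0 : (p : ℚ) ≠ 0 := by exact_mod_cast hp.ne_zero
  refine ⟨QuotientAddGroup.mk ⟨1 / p, 1, 1, by simp [hp0]⟩, fun h => ?_⟩
  rw [QuotientAddGroup.eq_zero_iff, AddSubgroup.mem_addSubgroupOf,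
    AddSubgroup.mem_zmultiples_iff] at h
  obtain ⟨m, hm⟩ := h
  have h1 : (m : ℚ) * p = 1 := by
    simp only [zsmul_eq_mul, mul_one] at hm
    rw [hm]
    exact div_mul_cancel₀ _ hp0
  have h2 : m * (p : ℤ) = 1 := by exact_mod_cast h1
  have h3 : (p : ℤ) ∣ 1 := ⟨m, by rw [← h2, mul_comm]⟩
  exact hp.one_lt.ne' (by exact_mod_cast Int.eq_one_of_dvd_one (by positivity) h3)

theorem PrueferGroup.smul_bijective {n : ℤ} (hn : IsCoprime n p) :
    Function.Bijective fun x : PrueferGroup p => n • x := by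
  refine ⟨(injective_iff_map_eq_zero (zsmulAddGroupHom n : PrueferGroup p →+ _)).2 fun x hx => ?_,
    fun x => ?_⟩
  · obtain ⟨k, hk⟩ := PrueferGroup.mem_pTorsion x
    obtain ⟨r, hr⟩ := exists_mul_smul_eq_self hk (m := n) hn.pow_right
    have hx' : n • x = 0 := hx
    rw [← hr, mul_smul, hx', smul_zero]
  · obtain ⟨k, hk⟩ := PrueferGroup.mem_pTorsion x
    obtain ⟨r, hr⟩ := exists_mul_smul_eq_self hk (m := n) hn.pow_right
    exact ⟨r • x, by
      change n • r • x = x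
      rw [← mul_smul, mul_comm, hr]⟩

end Pruefer

/-! ### Shears and dilations of P × ℤ -/

section Shear

open scoped commutatorElement

variable {P : Type*} [AddCommGroup P]

/-- The automorphism `(x, n) ↦ (x + n c, n)` of `P × ℤ`. -/
def shear (c : P) : AddAut (P × ℤ) where
  toFun x := (x.1 + x.2 • c, x.2)
  invFun x := (x.1 - x.2 • c, x.2)
  left_inv x := by simp
  right_inv x := by simp
  map_add' x y := by
    ext
    · simp only [Prod.fst_add, Prod.snd_add, add_smul]
      abel
    · rfl

/-- The automorphism `(x, n) ↦ (k x, n)` of `P × ℤ`. -/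
noncomputable def dilation (k : ℤ) (hk : Function.Bijective fun x : P => k • x) :
    AddAut (P × ℤ) :=
  AddEquiv.prodCongr (AddEquiv.ofBijective (zsmulAddGroupHom k : P →+ P) hk) (AddEquiv.refl ℤ)

/-- H is generated by H ∩ P, on which γ is multiplication by k, and one h₀ over a generator of its
projection to ℤ. The only new contribution is γ h₀ - h₀, which is torsion. -/
theorem isInertial_of_apply {γ : P × ℤ →+ P × ℤ} (hP : ∀ x : P, IsOfFinAddOrder x) {k : ℤ}
    {c : P} (h : ∀ x, γ x = (k • x.1 + x.2 • c, x.2)) : IsInertial γ := by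
  refine isInertial_of_finite_sup fun H => ?_
  obtain ⟨n₀, hn₀⟩ := Int.subgroup_cyclic (H.map (AddMonoidHom.snd P ℤ))
  have hmem : n₀ ∈ H.map (AddMonoidHom.snd P ℤ) := by
    rw [hn₀]
    exact AddSubgroup.subset_closure rfl
  obtain ⟨h₀, hh₀, rfl⟩ := hmem
  have hfst : γ h₀ - h₀ = (k • h₀.1 + h₀.2 • c - h₀.1, 0) := by
    rw [h]
    ext <;> simp
  have hfin : IsOfFinAddOrder (γ h₀ - h₀) := by
    rw [hfst]
    exact AddMonoidHom.isOfFinAddOrder (AddMonoidHom.inl P ℤ) (hP _)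
  refine ⟨AddSubgroup.zmultiples (γ h₀ - h₀),
    AddSubgroup.finite_zmultiples_of_isOfFinAddOrder hfin, ?_⟩
  rintro _ ⟨y, hy, rfl⟩
  have hy2 : y.2 ∈ H.map (AddMonoidHom.snd P ℤ) := ⟨y, hy, rfl⟩
  rw [hn₀, ← AddSubgroup.zmultiples_eq_closure, AddSubgroup.mem_zmultiples_iff] at hy2
  obtain ⟨j, hj⟩ := hy2
  have hj' : j • h₀.2 = y.2 := hj
  have hz : γ (y - j • h₀) = k • (y - j • h₀) := by
    rw [h]
    ext <;> simp [← hj']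
  have : γ y = (j • h₀ + k • (y - j • h₀)) + j • (γ h₀ - h₀) := by
    rw [← hz, map_sub, map_zsmul]
    module
  change γ y ∈ _
  rw [this]
  exact AddSubgroup.add_mem _ (AddSubgroup.mem_sup_left (H.add_mem (H.zsmul_mem hh₀ j)
    (H.zsmul_mem (H.sub_mem hy (H.zsmul_mem hh₀ j)) k)))
    (AddSubgroup.mem_sup_right (AddSubgroup.zsmul_mem _ (AddSubgroup.mem_zmultiples _) j))

theorem ofAdd_shear_mem_IAut (hP : ∀ x : P, IsOfFinAddOrder x) (c : P) :
    ofAdd (shear c) ∈ IAut (P × ℤ) :=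
  Subgroup.subset_closure (isInertial_of_apply hP (k := 1) (c := c) fun x => by
    rw [one_smul]; rfl)

theorem ofAdd_dilation_mem_IAut (hP : ∀ x : P, IsOfFinAddOrder x) (k : ℤ)
    (hk : Function.Bijective fun x : P => k • x) : ofAdd (dilation k hk) ∈ IAut (P × ℤ) :=
  Subgroup.subset_closure (isInertial_of_apply hP (k := k) (c := 0) fun x => by
    rw [smul_zero, add_zero]; rfl)

theorem ofAdd_dilation_pow_apply (k : ℤ) (hk : Function.Bijective fun x : P => k • x) (j : ℕ)
    (x : P × ℤ) : toAdd (ofAdd (dilation k hk) ^ j) x = (k ^ j • x.1, x.2) := by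
  induction j with
  | zero =>
    rw [pow_zero, pow_zero, one_smul]
    rfl
  | succ j ih =>
    rw [pow_succ']
    change dilation k hk (toAdd (ofAdd (dilation k hk) ^ j) x) = _
    rw [ih, pow_succ', mul_smul]
    rfl

theorem dilation_pow_mul_shear (k : ℤ) (hk : Function.Bijective fun x : P => k • x) (j : ℕ)
    (c : P) : ofAdd (dilation k hk) ^ j * ofAdd (shear c) =
      ofAdd (shear ((k ^ j - 1) • c)) * ofAdd (shear c) * ofAdd (dilation k hk) ^ j := by
  refine toAdd.injective (AddEquiv.ext fun x => ?_)
  change toAdd (ofAdd (dilation k hk) ^ j) (shear c x) =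
    shear ((k ^ j - 1) • c) (shear c (toAdd (ofAdd (dilation k hk) ^ j) x))
  rw [ofAdd_dilation_pow_apply, ofAdd_dilation_pow_apply]
  refine Prod.ext ?_ rfl
  change k ^ j • (x.1 + x.2 • c) = k ^ j • x.1 + x.2 • c + x.2 • (k ^ j - 1) • c
  module

theorem not_isNilpotentByLocallyFinite_IAut (hP : ∀ x : P, IsOfFinAddOrder x) {k : ℤ}
    (hk : Function.Bijective fun x : P => k • x)
    (hdiv : ∀ j : ℕ, 0 < j → ∀ x : P, ∃ y : P, (k ^ j - 1) • y = x) (hne : ∃ x : P, x ≠ 0) :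
    ¬ IsNilpotentByLocallyFinite (IAut (P × ℤ)) := by
  rintro ⟨N, hN, hnil, hlf⟩
  let u : IAut (P × ℤ) := ⟨_, ofAdd_dilation_mem_IAut hP k hk⟩
  let t : P → IAut (P × ℤ) := fun c => ⟨_, ofAdd_shear_mem_IAut hP c⟩
  have hfin := hlf (Subgroup.zpowers (QuotientGroup.mk u : IAut (P × ℤ) ⧸ N))
    ⟨{QuotientGroup.mk u}, by rw [Finset.coe_singleton, Subgroup.zpowers_eq_closure]⟩
  obtain ⟨j, hj, huj⟩ := isOfFinOrder_iff_pow_eq_one.1 (finite_zpowers.1 hfin)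
  have huN : u ^ j ∈ N := by
    rwa [← QuotientGroup.mk_pow, QuotientGroup.eq_one_iff] at huj
  have hcomm : ∀ c, t ((k ^ j - 1) • c) = u ^ j * t c * (u ^ j)⁻¹ * (t c)⁻¹ := by
    intro c
    rw [eq_mul_inv_iff_mul_eq, eq_mul_inv_iff_mul_eq]
    exact Subtype.ext (dilation_pow_mul_shear k hk j c).symm
  have hmem : ∀ n c, t c ∈ N.lowerCentralSeries n := by
    intro n
    induction n with
    | zero =>
      intro c
      -- Divisibility turns every shear into a commutator with u^j, which lies in the normal
      -- subgroup N.
      obtain ⟨c, rfl⟩ := hdiv j hj c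
      rw [hcomm, mul_assoc, mul_assoc]
      refine N.mul_mem huN ?_
      rw [← mul_assoc]
      exact hN.conj_mem _ (N.inv_mem huN) _
    | succ n ih =>
      intro c
      obtain ⟨c, rfl⟩ := hdiv j hj c
      rw [hcomm, ← commutatorElement_def, Subgroup.lowerCentralSeries_succ,
        ← commutatorElement_inv]
      exact Subgroup.inv_mem _ (Subgroup.commutator_mem_commutator (ih c) huN)
  obtain ⟨n, hn⟩ := N.isNilpotent_iff_lowerCentralSeries.1 hnil
  obtain ⟨x, hx⟩ := hne
  have h1 : t x = 1 := by
    rw [← Subgroup.mem_bot, ← hn]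
    exact hmem n x
  have h2 : ((0 : P) + (1 : ℤ) • x, (1 : ℤ)) = (0, 1) :=
    congrArg (fun g : IAut (P × ℤ) => toAdd g.1 ((0, 1) : P × ℤ)) h1
  apply hx
  simpa using h2

end Shear

/-- The factor 1 + p is prime to p, hence acts bijectively, and no positive power of it is 1, so
division by (1 + p)^j - 1 is possible. -/
theorem not_isNilpotentByLocallyFinite_IAut_PrueferGroup {p : ℕ} (hp : p.Prime) :
    ¬ IsNilpotentByLocallyFinite (IAut (PrueferGroup p × ℤ)) := by
  have hcop : IsCoprime (1 + p : ℤ) p := ⟨1, -1, by ring⟩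
  refine not_isNilpotentByLocallyFinite_IAut (k := 1 + p)
    (fun x => isOfFinAddOrder_of_mem_pTorsion hp (PrueferGroup.mem_pTorsion x))
    (PrueferGroup.smul_bijective hcop) (fun j hj => ?_) (PrueferGroup.exists_ne_zero hp)
  refine PrueferGroup.exists_smul_eq hp (sub_ne_zero.2 (ne_of_gt ?_))
  exact one_lt_pow₀ (by have := hp.pos; omega) hj.ne'

theorem corollaryB :
    (∀ (A : Type*) [AddCommGroup A], IsMetabelianByLocallyFinite (IAut A)) ∧
    (∀ p : ℕ, p.Prime → ¬ IsNilpotentByLocallyFinite (IAut (PrueferGroup p × ℤ))) :=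
  ⟨fun _ _ => isMetabelianByLocallyFinite_IAut,
    fun _ hp => not_isNilpotentByLocallyFinite_IAut_PrueferGroup hp⟩
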